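/- Let $N\ge 1$. Call a triple $(i,j,k)\in\{1,\dots,N\}^3$ cyclically ordered if some rotation of it is weakly increasing, with the additional condition that $i=j=k$ if $i=k$. For $N\times N$ matrices put $(P\bullet Q)_{ik}=\sum_j P_{ij}Q_{jk}$, the sum running over all $j$ for which $(i,j,k)$ is cyclically ordered. Let $E\subseteq M_N(\mathbb C)$ be the closed subscheme defined by the equations $M\bullet M=0$ and $M_{ii}=0$ for $i=1,\dots,N$. A link pattern is an involution $\pi$ of $\{1,\dots,N\}$ with exactly one fixed point if $N$ is odd and none if $N$ is even. Let $\underline\pi$ be the permutation matrix of $\pi$ with its diagonal zeroed out. For a link pattern $\pi$ let $E_\pi$ be the closure in $E$, with the scheme structure inherited from $E$ (scheme-theoretic closure), of the open subscheme $$E_\pi^\circ=\{M\in E : (M^2)_{ii}=(M^2)_{jj}\text{ if and only if } j\in\{i,\pi(i)\}\},$$ where $M^2$ is the ordinary square. Theorem. Let $\pi$ be a link pattern. Then $E_\pi^\circ$ is indeed open in $E$, and: 1. There is a nonzero polynomial $f\in\mathbb C[t_1,\dots,t_N]$ such that for every diagonal matrix $t=\mathrm{diag}(t_1,\dots,t_N)$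 with $f(t_1,\dots,t_N)\neq 0$ the matrix $\underline\pi\,t$ is a point of $E_\pi$, the local rings of $E_\pi$ and of $E$ at $\underline\pi\, t$ are reduced, and the Zariski tangent spaces of $E_\pi$ and of $E$ at $\underline\pi\, t$ have dimension $\lfloor N^2/2\rfloor$. 2. Hence $E_\pi$ is generically reduced (it has a dense open subscheme that is reduced), and $E$ is generically reduced along $E_\pi$ (there is a reduced open subscheme $W$ of $E$ such that $W\cap E_\pi$ is dense in $E_\pi$). -/

import Mathlib

namespace BrauerLoop

/-- The triple `(i, j, k)` is cyclically ordered: some rotation of it is weakly increasing, and all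
three entries agree if the first and the last do. -/
def CycLE {N : ℕ} (i j k : Fin N) : Prop :=
  ((i ≤ j ∧ j ≤ k) ∨ (j ≤ k ∧ k ≤ i) ∨ (k ≤ i ∧ i ≤ j)) ∧ (i = k → i = j ∧ j = k)

instance {N : ℕ} (i j k : Fin N) : Decidable (CycLE i j k) := by
  unfold CycLE
  infer_instance

/-- The degenerate matrix product `(P • Q)_{ik} = ∑_{j : i ≤ j ≤ k cyclically} P_{ij} Q_{jk}`. -/
def cprod {N : ℕ} {R : Type*} [CommRing R] (P Q : Matrix (Fin N) (Fin N) R) :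
    Matrix (Fin N) (Fin N) R :=
  Matrix.of fun i k => ∑ j with CycLE i j k, P i j * Q j k

/-- The generic `N × N` matrix, whose entries are the coordinate functions on `M_N(ℂ)`. -/
noncomputable abbrev genericMatrix (N : ℕ) :
    Matrix (Fin N) (Fin N) (MvPolynomial (Fin N × Fin N) ℂ) :=
  Matrix.mvPolynomialX (Fin N) (Fin N) ℂ

/-- The ideal generated by the entries of `M • M` and the diagonal entries of `M`, where `M` is the
generic matrix. -/
noncomputable def brauerIdeal (N : ℕ) : Ideal (MvPolynomial (Fin N × Fin N) ℂ) :=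
  Ideal.span
    ({f | ∃ i k, f = cprod (genericMatrix N) (genericMatrix N) i k} ∪
      {f | ∃ i, f = genericMatrix N i i})

/-- The coordinate ring of the Brauer loop scheme. -/
abbrev BrauerRing (N : ℕ) : Type := MvPolynomial (Fin N × Fin N) ℂ ⧸ brauerIdeal N

/-- The Brauer loop scheme `E = {M ∈ M_N(ℂ) : M • M = 0, diag M = 0}`. -/
noncomputable abbrev brauerScheme (N : ℕ) : AlgebraicGeometry.Scheme.{0} :=
  AlgebraicGeometry.Spec (CommRingCat.of (BrauerRing N))

/-- The complex matrices satisfying the defining equations of `E`. -/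
def brauerSet (N : ℕ) : Set (Matrix (Fin N) (Fin N) ℂ) :=
  {M | cprod M M = 0 ∧ ∀ i, M i i = 0}

theorem brauerIdeal_eval_eq_zero {N : ℕ} {M : Matrix (Fin N) (Fin N) ℂ} (hM : M ∈ brauerSet N)
    (f : MvPolynomial (Fin N × Fin N) ℂ) (hf : f ∈ brauerIdeal N) :
    MvPolynomial.eval (fun p => M p.1 p.2) f = 0 := by
  have h : brauerIdeal N ≤ RingHom.ker (MvPolynomial.eval (fun p : Fin N × Fin N => M p.1 p.2)) := by
    refine Ideal.span_le.2 ?_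
    rintro g (⟨i, k, rfl⟩ | ⟨i, rfl⟩)
    · have := congrFun (congrFun hM.1 i) k
      simpa [RingHom.mem_ker, cprod] using this
    · simpa [RingHom.mem_ker] using hM.2 i
  exact h hf

/-- Evaluation of regular functions on `E` at a complex matrix lying on `E`. -/
noncomputable def evalAt {N : ℕ} (M : Matrix (Fin N) (Fin N) ℂ) (hM : M ∈ brauerSet N) :
    BrauerRing N →+* ℂ :=
  Ideal.Quotient.lift (brauerIdeal N) (MvPolynomial.eval fun p => M p.1 p.2)
    (brauerIdeal_eval_eq_zero hM)

/-- The closed point of `E` given by a complex matrix lying on `E`. -/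
noncomputable def matrixPoint {N : ℕ} (M : Matrix (Fin N) (Fin N) ℂ) (hM : M ∈ brauerSet N) :
    brauerScheme N :=
  (⟨RingHom.ker (evalAt M hM), RingHom.ker_isPrime _⟩ : PrimeSpectrum (BrauerRing N))

/-- A link pattern: an involution of `{1, …, N}` with one fixed point if `N` is odd, and none if
`N` is even. -/
structure IsLinkPattern {N : ℕ} (π : Equiv.Perm (Fin N)) : Prop where
  involutive : ∀ i, π (π i) = i
  card_fixed : Fintype.card {i // π i = i} = N % 2

/-- The permutation matrix of `π` with its diagonal zeroed out. -/
def linkMatrix {N : ℕ} (π : Equiv.Perm (Fin N)) : Matrix (Fin N) (Fin N) ℂ :=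
  Matrix.of fun i j => if i = π j ∧ i ≠ j then 1 else 0

/-- The function `M ↦ (M²)_{ii}` on `E`, where `M²` is the ordinary square. -/
noncomputable def sqDiag (N : ℕ) (i : Fin N) : BrauerRing N :=
  Ideal.Quotient.mk (brauerIdeal N) ((genericMatrix N * genericMatrix N) i i)

/-- The locus `{M ∈ E : (M²)_{ii} = (M²)_{jj} if and only if j ∈ {i, π i}}`; at a point `x` of the
scheme `E` the equalities are those of values in the residue field of `x`. -/
def linkLocus {N : ℕ} (π : Equiv.Perm (Fin N)) : Set (brauerScheme N) :=
  {x | ∀ i j : Fin N, sqDiag N i - sqDiag N j ∈ PrimeSpectrum.asIdeal x ↔ (j = i ∨ j = π i)}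

/-- `linkLocus π` as an open subscheme of `E`. For link patterns the locus is open, so that it
equals its interior; taking the interior only makes the definition independent of that fact. -/
def linkOpen {N : ℕ} (π : Equiv.Perm (Fin N)) : (brauerScheme N).Opens :=
  ⟨interior (linkLocus π), isOpen_interior⟩

/-- The scheme `E_π`: the scheme-theoretic closure in `E` of the open subscheme `linkOpen π`. -/
noncomputable abbrev component {N : ℕ} (π : Equiv.Perm (Fin N)) : AlgebraicGeometry.Scheme.{0} :=
  (linkOpen π).ι.image

/-- The closed immersion `E_π → E`. -/
noncomputable abbrev componentι {N : ℕ} (π : Equiv.Perm (Fin N)) : component π ⟶ brauerScheme N :=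
  (linkOpen π).ι.imageι

/-- A scheme is reduced at a point if its local ring there is reduced. -/
def IsReducedAt (X : AlgebraicGeometry.Scheme.{0}) (x : X) : Prop :=
  _root_.IsReduced (X.presheaf.stalk x)

/-- The dimension of the Zariski tangent space `(𝔪/𝔪²)^*` of a scheme at a point, over the residue
field of that point. -/
noncomputable def tangentDim (X : AlgebraicGeometry.Scheme.{0}) (x : X) : ℕ :=
  Module.finrank (IsLocalRing.ResidueField (X.presheaf.stalk x))
    (Module.Dual (IsLocalRing.ResidueField (X.presheaf.stalk x))
      (IsLocalRing.CotangentSpace (X.presheaf.stalk x)))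

end BrauerLoop

/-! ### The degenerate product and the ring it defines -/

namespace BrauerLoop

variable {N : ℕ} {R S : Type*} [CommRing R] [CommRing S]

/-! Split the ordinary product as `cprod + wrapProd`. A step from `i` to `j` has length `cycDist i
j`, and a term belongs to `wrapProd` exactly when its two steps overshoot by a full turn. Counting
turns shows that `cprod + z • wrapProd` is associative. Degree zero makes matrices a ring `CycMat`
in which a zero diagonal implies nilpotence. Degree one shows that if `M • M = 0`, then `M` commutes
in this ring with `wrap M M = M²`.

Where the diagonal of `M²` separates the orbits of `π` by units, a unipotent conjugation makes `M²`
supported on these orbits. The conjugated `M`, commuting with it, is then supported on `π`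
(`exists_normal_form`). This holds over every commutative ring, so it applies to the universal point
of the localisation of `E` at `separator π`. The localisation map therefore factors through a
polynomial ring, and the localisation is reduced. The normal form also gives `(M²)_{ii} = (M²)_{π i,
π i}`, so `E_π°` is the basic open set of `separator π`.

The tangent space at `π t` is the solution space of the linearised equations. These decouple into
systems in the two unknowns at `(a, b)` and `(π a, π b)`. For generic `t` the coordinates at free
positions parametrise the solutions, and an involution shows that there are `⌊N²/2⌋` free positions.
Finally `E_π°` is open and dense in `E_π`, so the local rings of `E_π` and `E` agree at its points.
-/

/-- Both sides say that the walk `i → j → l → k` in the positive direction exceeds the direct step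
`i → k` by no full turn. In `cycLE_assoc_xor` the excess is exactly one turn. -/
theorem cycLE_assoc_iff (i j l k : Fin N) :
    (CycLE i j l ∧ CycLE i l k) ↔ (CycLE j l k ∧ CycLE i j k) := by
  simp only [CycLE, Fin.ext_iff, Fin.le_def]; omega

theorem cycLE_assoc_xor (i j l k : Fin N) :
    ((¬ CycLE i j l ∧ CycLE i l k) ∨ (CycLE i j l ∧ ¬ CycLE i l k)) ↔
      ((¬ CycLE j l k ∧ CycLE i j k) ∨ (CycLE j l k ∧ ¬ CycLE i j k)) := by
  simp only [CycLE, Fin.ext_iff, Fin.le_def]; omega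

theorem cycLE_left (i k : Fin N) : CycLE i i k :=
  ⟨(le_total i k).elim (fun h => Or.inl ⟨le_rfl, h⟩) fun h => Or.inr (Or.inr ⟨h, le_rfl⟩),
    fun h => ⟨rfl, h⟩⟩

theorem cycLE_right (i k : Fin N) : CycLE i k k :=
  ⟨(le_total i k).elim (fun h => Or.inl ⟨h, le_rfl⟩) fun h => Or.inr (Or.inl ⟨le_rfl, h⟩),
    fun h => ⟨h, rfl⟩⟩

theorem cycLE_self_iff {i j : Fin N} : CycLE i j i ↔ j = i :=
  ⟨fun h => (h.2 rfl).2, fun h => h ▸ cycLE_left _ _⟩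

/-- The number of steps from `i` to `k` in the positive cyclic direction. -/
def cycDist (i k : Fin N) : ℕ := if i ≤ k then k - i else k + N - i

theorem cycDist_lt (i k : Fin N) : cycDist i k < N := by
  simp only [cycDist, Fin.le_def]; split <;> omega

theorem cycDist_eq_zero {i k : Fin N} : cycDist i k = 0 ↔ i = k := by
  simp only [cycDist, Fin.le_def, Fin.ext_iff]; split <;> omega

theorem CycLE.cycDist_add {i j k : Fin N} (h : CycLE i j k) :
    cycDist i j + cycDist j k = cycDist i k := by
  simp only [CycLE, Fin.ext_iff, Fin.le_def] at h
  simp only [cycDist, Fin.le_def]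
  split_ifs <;> omega

theorem cprod_apply (P Q : Matrix (Fin N) (Fin N) R) (i k : Fin N) :
    cprod P Q i k = ∑ j, if CycLE i j k then P i j * Q j k else 0 := by
  simp [cprod, Finset.sum_filter]

/-- The part of the matrix product complementary to the degenerate product `cprod`. -/
def wrapProd (P Q : Matrix (Fin N) (Fin N) R) : Matrix (Fin N) (Fin N) R :=
  Matrix.of fun i k => ∑ j, if CycLE i j k then 0 else P i j * Q j k

theorem wrapProd_apply (P Q : Matrix (Fin N) (Fin N) R) (i k : Fin N) :
    wrapProd P Q i k = ∑ j, if CycLE i j k then 0 else P i j * Q j k := rfl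

theorem cprod_add_wrapProd (P Q : Matrix (Fin N) (Fin N) R) :
    cprod P Q + wrapProd P Q = P * Q := by
  ext i k
  rw [Matrix.add_apply, cprod_apply, wrapProd_apply, Matrix.mul_apply, ← Finset.sum_add_distrib]
  refine Finset.sum_congr rfl fun j _ => ?_
  split_ifs <;> simp

theorem cprod_assoc (P Q T : Matrix (Fin N) (Fin N) R) :
    cprod (cprod P Q) T = cprod P (cprod Q T) := by
  ext i k
  simp only [cprod_apply]
  have h1 : ∀ l : Fin N, (if CycLE i l k then (∑ j, if CycLE i j l then P i j * Q j l else 0) * T l k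
      else 0) = ∑ j, if CycLE i j l ∧ CycLE i l k then P i j * Q j l * T l k else 0 := by
    intro l
    by_cases h : CycLE i l k <;> simp [h, ite_mul, Finset.sum_mul]
  have h2 : ∀ j : Fin N, (if CycLE i j k then P i j * (∑ l, if CycLE j l k then Q j l * T l k else 0)
      else 0) = ∑ l, if CycLE j l k ∧ CycLE i j k then P i j * Q j l * T l k else 0 := by
    intro j
    by_cases h : CycLE i j k <;> simp [h, mul_ite, mul_assoc, Finset.mul_sum]
  rw [Finset.sum_congr rfl fun l _ => h1 l, Finset.sum_congr rfl fun j _ => h2 j, Finset.sum_comm]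
  exact Finset.sum_congr rfl fun j _ => Finset.sum_congr rfl fun l _ =>
    if_congr (cycLE_assoc_iff i j l k) rfl rfl

/-- Associativity of `cprod + z • wrapProd` in degree one in `z`. -/
theorem wrapProd_assoc (P Q T : Matrix (Fin N) (Fin N) R) :
    cprod (wrapProd P Q) T + wrapProd (cprod P Q) T =
      cprod P (wrapProd Q T) + wrapProd P (cprod Q T) := by
  ext i k
  simp only [Matrix.add_apply, cprod_apply, wrapProd_apply]
  rw [← Finset.sum_add_distrib, ← Finset.sum_add_distrib]
  have h1 : ∀ l : Fin N,
      ((if CycLE i l k then (∑ j, if CycLE i j l then 0 else P i j * Q j l) * T l k else 0) +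
       (if CycLE i l k then 0 else (∑ j, if CycLE i j l then P i j * Q j l else 0) * T l k)) =
      ∑ j, if ((¬ CycLE i j l ∧ CycLE i l k) ∨ (CycLE i j l ∧ ¬ CycLE i l k))
        then P i j * Q j l * T l k else 0 := by
    intro l
    by_cases h : CycLE i l k <;> simp [h, ite_mul, ite_not, Finset.sum_mul]
  have h2 : ∀ j : Fin N,
      ((if CycLE i j k then P i j * (∑ l, if CycLE j l k then 0 else Q j l * T l k) else 0) +
       (if CycLE i j k then 0 else P i j * (∑ l, if CycLE j l k then Q j l * T l k else 0))) =
      ∑ l, if ((¬ CycLE j l k ∧ CycLE i j k) ∨ (CycLE j l k ∧ ¬ CycLE i j k))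
        then P i j * Q j l * T l k else 0 := by
    intro j
    by_cases h : CycLE i j k <;> simp [h, mul_ite, mul_assoc, Finset.mul_sum, ite_not]
  rw [Finset.sum_congr rfl fun l _ => h1 l, Finset.sum_congr rfl fun j _ => h2 j, Finset.sum_comm]
  exact Finset.sum_congr rfl fun j _ => Finset.sum_congr rfl fun l _ =>
    if_congr (cycLE_assoc_xor i j l k) rfl rfl

/-- Square matrices as a ring under the degenerate product. -/
def CycMat (N : ℕ) (R : Type*) : Type _ := Matrix (Fin N) (Fin N) R

namespace CycMat

instance : AddCommGroup (CycMat N R) := inferInstanceAs (AddCommGroup (Matrix (Fin N) (Fin N) R))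

instance : Mul (CycMat N R) := ⟨fun P Q => cprod P Q⟩

instance : One (CycMat N R) := ⟨(1 : Matrix (Fin N) (Fin N) R)⟩

theorem mul_apply (P Q : CycMat N R) (i k : Fin N) :
    (P * Q) i k = ∑ j, if CycLE i j k then P i j * Q j k else 0 := cprod_apply P Q i k

theorem one_apply (i k : Fin N) : (1 : CycMat N R) i k = if i = k then 1 else 0 :=
  Matrix.one_apply

@[simp] theorem add_apply (P Q : CycMat N R) (i k : Fin N) : (P + Q) i k = P i k + Q i k := rfl
@[simp] theorem sub_apply (P Q : CycMat N R) (i k : Fin N) : (P - Q) i k = P i k - Q i k := rfl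
@[simp] theorem zero_apply (i k : Fin N) : (0 : CycMat N R) i k = 0 := rfl

omit [CommRing R] in
@[ext] theorem ext {P Q : CycMat N R} (h : ∀ i k, P i k = Q i k) : P = Q :=
  Matrix.ext h

theorem one_apply_self (i : Fin N) : (1 : CycMat N R) i i = 1 := by simp [one_apply]

instance : Ring (CycMat N R) :=
  { (inferInstance : AddCommGroup (CycMat N R)) with
    mul := (· * ·)
    one := 1
    mul_assoc := fun P Q T => cprod_assoc P Q T
    one_mul := fun P => by
      ext i k
      rw [mul_apply, Finset.sum_eq_single i]
      · simp [one_apply, cycLE_left]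
      · intro j _ hj
        simp [one_apply, hj.symm]
      · simp
    mul_one := fun P => by
      ext i k
      rw [mul_apply, Finset.sum_eq_single k]
      · simp [one_apply, cycLE_right]
      · intro j _ hj
        simp [one_apply, hj]
      · simp
    left_distrib := fun P Q T => by
      ext i k
      simp only [mul_apply, add_apply, mul_add, ← Finset.sum_add_distrib]
      refine Finset.sum_congr rfl fun j _ => ?_
      split_ifs <;> simp
    right_distrib := fun P Q T => by
      ext i k
      simp only [mul_apply, add_apply, add_mul, ← Finset.sum_add_distrib]
      refine Finset.sum_congr rfl fun j _ => ?_
      split_ifs <;> simp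
    zero_mul := fun P => by ext i k; simp [mul_apply]
    mul_zero := fun P => by ext i k; simp [mul_apply] }

/-- Entrywise application of a ring homomorphism. -/
def map (f : R →+* S) : CycMat N R →+* CycMat N S where
  toFun P := Matrix.map P f
  map_zero' := by ext i k; exact f.map_zero
  map_one' := by
    ext i k
    change f ((1 : CycMat N R) i k) = _
    simp only [one_apply]; split_ifs <;> simp
  map_add' P Q := by ext i k; exact f.map_add _ _
  map_mul' P Q := by
    ext i k
    change f ((P * Q) i k) = cprod (Matrix.map P f) (Matrix.map Q f) i k
    rw [mul_apply, cprod_apply, map_sum f]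
    refine Finset.sum_congr rfl fun j _ => ?_
    split_ifs
    · exact f.map_mul _ _
    · simp

@[simp] theorem map_apply (f : R →+* S) (P : CycMat N R) (i k : Fin N) :
    map f P i k = f (P i k) := rfl

theorem mul_apply_self (P Q : CycMat N R) (i : Fin N) : (P * Q) i i = P i i * Q i i := by
  rw [mul_apply, Finset.sum_eq_single i]
  · simp [cycLE_left]
  · intro j _ hj
    simp [cycLE_self_iff, hj]
  · simp

/-- Cyclic distances add along nonzero terms of the degenerate product, and a factor with zero
diagonal contributes at least one step. -/
theorem pow_apply_eq_zero {P : CycMat N R} (hP : ∀ i, P i i = 0) (m : ℕ) (i k : Fin N)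
    (h : cycDist i k < m) : (P ^ m) i k = 0 := by
  induction m generalizing i k with
  | zero => omega
  | succ m ih =>
    rw [pow_succ, mul_apply]
    refine Finset.sum_eq_zero fun j _ => ?_
    split_ifs with hj
    · have := hj.cycDist_add
      by_cases hjk : j = k
      · subst hjk; simp [hP]
      · have : cycDist j k ≠ 0 := fun h => hjk (cycDist_eq_zero.1 h)
        rw [ih i j (by omega), zero_mul]
    · rfl

theorem isNilpotent_of_diag_eq_zero {P : CycMat N R} (hP : ∀ i, P i i = 0) : IsNilpotent P :=
  ⟨N, by ext i k; exact pow_apply_eq_zero hP N i k (cycDist_lt i k)⟩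

theorem isUnit_of_diag_eq_one {P : CycMat N R} (hP : ∀ i, P i i = 1) : IsUnit P := by
  have h : IsNilpotent (P - 1) :=
    isNilpotent_of_diag_eq_zero fun i => by simp [hP, one_apply_self]
  simpa using h.isUnit_one_add

theorem inv_apply_self {u : (CycMat N R)ˣ} (hu : ∀ i, (u : CycMat N R) i i = 1) (i : Fin N) :
    (↑u⁻¹ : CycMat N R) i i = 1 := by
  have h := congrArg (fun P : CycMat N R => P i i) u.mul_inv
  simpa [mul_apply_self, hu, one_apply_self] using h

theorem conj_apply_self (u : (CycMat N R)ˣ) (P : CycMat N R) (i : Fin N) :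
    ((u : CycMat N R) * P * (↑u⁻¹ : CycMat N R)) i i = P i i := by
  have h := congrArg (fun P : CycMat N R => P i i) u.mul_inv
  simp only [mul_apply_self, one_apply_self] at h ⊢
  linear_combination P i i * h

/-- Since distances add, an `X` concentrated at distance `m` meets only the diagonal of `P` up to
that distance. Conjugation by `1 + X` is thereby computable to leading order. -/
theorem mul_apply_of_support_right {X : CycMat N R} {m : ℕ}
    (hX : ∀ j k, cycDist j k ≠ m → X j k = 0) (P : CycMat N R) {i k : Fin N}
    (h : cycDist i k ≤ m) : (P * X) i k = P i i * X i k := by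
  rw [mul_apply, Finset.sum_eq_single i]
  · simp [cycLE_left]
  · intro j _ hj
    split_ifs with hc
    · have := hc.cycDist_add
      have : cycDist i j ≠ 0 := fun h => hj (cycDist_eq_zero.1 h).symm
      rw [hX j k (by omega), mul_zero]
    · rfl
  · simp

theorem mul_apply_of_support_left {X : CycMat N R} {m : ℕ}
    (hX : ∀ j k, cycDist j k ≠ m → X j k = 0) (P : CycMat N R) {i k : Fin N}
    (h : cycDist i k ≤ m) : (X * P) i k = X i k * P k k := by
  rw [mul_apply, Finset.sum_eq_single k]
  · simp [cycLE_right]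
  · intro j _ hj
    split_ifs with hc
    · have := hc.cycDist_add
      have : cycDist j k ≠ 0 := fun h => hj (cycDist_eq_zero.1 h)
      rw [hX i j (by omega), zero_mul]
    · rfl
  · simp

end CycMat
end BrauerLoop

/-! ### Normal form under unipotent conjugation -/

namespace BrauerLoop

variable {N : ℕ} {R S : Type*} [CommRing R] [CommRing S]

namespace CycMat

/-- If the diagonal entries of `B` at positions in different orbits of `π` differ by units, then `B`
is conjugate to a matrix supported on the orbits of `π`, up to any given cyclic distance. -/
theorem exists_conj_eq_zero_of_lt (B : CycMat N R) (π : Equiv.Perm (Fin N))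
    (hB : ∀ i j, j ≠ i → j ≠ π i → IsUnit (B i i - B j j)) (m : ℕ) :
    ∃ u : (CycMat N R)ˣ, (∀ i, (u : CycMat N R) i i = 1) ∧
      ∀ i k, k ≠ i → k ≠ π i → cycDist i k < m →
        ((u : CycMat N R) * B * (↑u⁻¹ : CycMat N R)) i k = 0 := by
  induction m with
  | zero => exact ⟨1, fun i => by simp [one_apply_self], fun i k _ _ h => absurd h (by omega)⟩
  | succ m ih =>
    obtain ⟨u, hu, hu0⟩ := ih
    set B' : CycMat N R := (u : CycMat N R) * B * (↑u⁻¹ : CycMat N R) with hB'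
    have hdiag : ∀ i, B' i i = B i i := conj_apply_self u B
    -- The entries solve `(B i i - B k k) * X i k = B' i k`, which is what makes conjugation by `1 +
    -- X` cancel the unwanted entries at distance `m`.
    let X : CycMat N R := fun i k =>
      if h : cycDist i k = m ∧ k ≠ i ∧ k ≠ π i then ↑(hB i k h.2.1 h.2.2).unit⁻¹ * B' i k else 0
    have hX : ∀ j k, cycDist j k ≠ m → X j k = 0 := fun j k h => dif_neg fun h' => h h'.1
    have hX0 : ∀ i, X i i = 0 := fun i => dif_neg fun h' => h'.2.1 rfl
    have h1X : ∀ i, (1 + X) i i = 1 := fun i => by simp [hX0, one_apply_self]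
    obtain ⟨v, hv⟩ := isUnit_of_diag_eq_one h1X
    have hvu : ((v * u : (CycMat N R)ˣ) : CycMat N R) * B * (↑(v * u)⁻¹ : CycMat N R) =
        (v : CycMat N R) * B' * (↑v⁻¹ : CycMat N R) := by
      rw [hB', mul_inv_rev, Units.val_mul, Units.val_mul]; noncomm_ring
    refine ⟨v * u, fun i => ?_, fun i k hki hkπ hd => ?_⟩
    · rw [Units.val_mul, mul_apply_self, hu, hv, h1X, one_mul]
    · rw [hvu]
      set C : CycMat N R := (v : CycMat N R) * B' * (↑v⁻¹ : CycMat N R) with hC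
      have hCdiag : ∀ i, C i i = B i i := fun i => (conj_apply_self v B' i).trans (hdiag i)
      -- Comparing entries in this form avoids expanding the inverse of `1 + X`.
      have hCv : C * v = v * B' := by rw [hC, Units.inv_mul_cancel_right]
      rw [hv, mul_add, add_mul, mul_one, one_mul] at hCv
      have h := congrArg (fun P : CycMat N R => P i k) hCv
      simp only [add_apply] at h
      rw [mul_apply_of_support_right hX C (by omega), mul_apply_of_support_left hX B' (by omega),
        hCdiag, hdiag] at h
      -- Below distance `m` the correction `X` vanishes, so zeros obtained earlier survive.
      rcases Nat.lt_succ_iff_lt_or_eq.1 hd with hlt | heq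
      · rw [hX i k hlt.ne, hu0 i k hki hkπ hlt] at h
        simpa using h
      · have hXik : X i k = ↑(hB i k hki hkπ).unit⁻¹ * B' i k := dif_pos ⟨heq, hki, hkπ⟩
        have hinv : (B i i - B k k) * ↑(hB i k hki hkπ).unit⁻¹ = 1 :=
          (hB i k hki hkπ).mul_val_inv
        rw [hXik] at h
        linear_combination h - B' i k * hinv

theorem exists_conj_eq_zero (B : CycMat N R) (π : Equiv.Perm (Fin N))
    (hB : ∀ i j, j ≠ i → j ≠ π i → IsUnit (B i i - B j j)) :
    ∃ u : (CycMat N R)ˣ, (∀ i, (u : CycMat N R) i i = 1) ∧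
      ∀ i k, k ≠ i → k ≠ π i → ((u : CycMat N R) * B * (↑u⁻¹ : CycMat N R)) i k = 0 := by
  obtain ⟨u, hu, h⟩ := exists_conj_eq_zero_of_lt B π hB N
  exact ⟨u, hu, fun i k hi hk => h i k hi hk (cycDist_lt i k)⟩

/-- A matrix with zero diagonal commuting with a matrix supported on the orbits of `π`, whose
diagonal separates these orbits, is itself supported on the orbits of `π`. -/
theorem eq_zero_of_commute {A B : CycMat N R} {π : Equiv.Perm (Fin N)}
    (hπ : ∀ i, π (π i) = i) (hA : ∀ i, A i i = 0) (hAB : A * B = B * A)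
    (hB : ∀ i k, k ≠ i → k ≠ π i → B i k = 0)
    (hu : ∀ i j, j ≠ i → j ≠ π i → IsUnit (B i i - B j j)) (i k : Fin N) (hk : k ≠ π i) :
    A i k = 0 := by
  induction hd : cycDist i k using Nat.strong_induction_on generalizing i k with
  | _ d ih =>
    by_cases hki : k = i
    · rw [hki, hA]
    have h := congrArg (fun P : CycMat N R => P i k) hAB
    -- An off-diagonal entry of `B` can contribute only for `j = π k`. Then `A i j` lies at a
    -- smaller distance and vanishes by induction, because `j = π i` would force `k = i`. The same
    -- argument for `B * A` leaves `(B i i - B k k) * A i k = 0`.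
    have h1 : (A * B) i k = A i k * B k k := by
      rw [mul_apply, Finset.sum_eq_single k]
      · simp [cycLE_right]
      · intro j _ hj
        split_ifs with hc
        · by_cases hjk : k = π j
          · have := hc.cycDist_add
            have : cycDist j k ≠ 0 := fun h => hj (cycDist_eq_zero.1 h)
            rw [ih (cycDist i j) (by omega) i j ?_ rfl, zero_mul]
            rintro rfl
            exact hki (by rw [hjk, hπ])
          · rw [hB j k hj.symm hjk, mul_zero]
        · rfl
      · simp
    have h2 : (B * A) i k = B i i * A i k := by
      rw [mul_apply, Finset.sum_eq_single i]
      · simp [cycLE_left]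
      · intro j _ hj
        split_ifs with hc
        · by_cases hij : j = π i
          · have := hc.cycDist_add
            have : cycDist i j ≠ 0 := fun h => hj (cycDist_eq_zero.1 h).symm
            rw [ih (cycDist j k) (by omega) j k ?_ rfl, mul_zero]
            rw [hij, hπ]; exact hki
          · rw [hB i j hj hij, zero_mul]
        · rfl
      · simp
    simp only [h1, h2] at h
    refine (hu i k hki hk).mul_right_eq_zero.1 ?_
    linear_combination -h

theorem wrapProd_eq_mul {M : Matrix (Fin N) (Fin N) R} (h : cprod M M = 0) :
    wrapProd M M = M * M := by
  rw [← cprod_add_wrapProd, h, zero_add]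

/-- The product `wrapProd` as an operation on `CycMat`. -/
def wrap (P Q : CycMat N R) : CycMat N R := wrapProd P Q

theorem wrap_apply (P Q : CycMat N R) (i k : Fin N) :
    wrap P Q i k = ∑ j, if CycLE i j k then 0 else P i j * Q j k := rfl

theorem wrap_assoc (P Q T : CycMat N R) :
    wrap P Q * T + wrap (P * Q) T = P * wrap Q T + wrap P (Q * T) :=
  wrapProd_assoc P Q T

theorem zero_wrap (P : CycMat N R) : wrap 0 P = 0 := by ext i k; simp [wrap_apply]

theorem wrap_zero (P : CycMat N R) : wrap P 0 = 0 := by ext i k; simp [wrap_apply]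

/-- This is degree-one associativity for three copies of `M`, where the terms containing `M * M`
drop out. -/
theorem mul_wrap_self_comm {M : CycMat N R} (h : M * M = 0) : M * wrap M M = wrap M M * M := by
  have h1 := wrap_assoc M M M
  rw [h, zero_wrap, wrap_zero, add_zero, add_zero] at h1
  exact h1.symm

/-- On the diagonal the degenerate product is entrywise, so the two remaining terms of `wrap_assoc`
vanish with the diagonals of `P` and `T`. -/
theorem wrap_mul_apply_self {P T : CycMat N R} (hP : ∀ i, P i i = 0) (hT : ∀ i, T i i = 0)
    (Q : CycMat N R) (i : Fin N) : wrap (P * Q) T i i = wrap P (Q * T) i i := by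
  have h := congrArg (fun P : CycMat N R => P i i) (wrap_assoc P Q T)
  simpa [mul_apply_self, hP, hT] using h

/-- The diagonal of `wrap M M` is invariant under conjugation. -/
theorem wrap_conj_apply_self {T : CycMat N R} (hT : T * T = 0) (hT0 : ∀ i, T i i = 0)
    {u : (CycMat N R)ˣ} (hu : ∀ i, (u : CycMat N R) i i = 1) (i : Fin N) :
    wrap ((u : CycMat N R) * T * (↑u⁻¹ : CycMat N R)) ((u : CycMat N R) * T * (↑u⁻¹ : CycMat N R)) i i = wrap T T i i := by
  have hv := inv_apply_self hu
  set v : CycMat N R := ↑u⁻¹ with hvdef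
  have huT : ∀ i, ((u : CycMat N R) * T) i i = 0 := fun i => by simp [mul_apply_self, hT0]
  have hTv : ∀ i, (T * v) i i = 0 := fun i => by simp [mul_apply_self, hT0]
  have huTv : ∀ i, ((u : CycMat N R) * T * v) i i = 0 := fun i => by
    simp [mul_apply_self, hT0]
  rw [wrap_mul_apply_self huT huTv]
  have h1 : v * ((u : CycMat N R) * T * v) = T * v := by
    rw [mul_assoc (u : CycMat N R), hvdef, Units.inv_mul_cancel_left]
  -- With the inner `v * u` cancelled, `h2` removes the outer `u` and `h3` the outer `v`; both use
  -- `T * T = 0` and unit diagonals.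
  have h2 := congrArg (fun P : CycMat N R => P i i) (wrap_assoc (u : CycMat N R) T (T * v))
  have h3 := congrArg (fun P : CycMat N R => P i i) (wrap_assoc T T v)
  rw [← mul_assoc T T v, hT, zero_mul, wrap_zero] at h2
  rw [hT, zero_wrap] at h3
  simp only [add_apply, mul_apply_self, hT0, hu, hv, zero_apply, mul_zero, zero_mul, zero_add,
    add_zero, one_mul, mul_one] at h2 h3
  rw [h1, h2, h3]

/-- Shape of a matrix supported on the off-diagonal part of the permutation matrix of `π`. -/
def IsLinkShaped (π : Equiv.Perm (Fin N)) (T : CycMat N R) : Prop :=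
  (∀ i, T i i = 0) ∧ ∀ i k, k ≠ π i → T i k = 0

/-- Normal form: where the diagonal of `M²` separates the orbits of `π`, a solution of `M • M = 0`
with zero diagonal is conjugate to a matrix supported on `π`. -/
theorem exists_normal_form {M : CycMat N R} {π : Equiv.Perm (Fin N)} (hπ : ∀ i, π (π i) = i)
    (hM : M * M = 0) (hM0 : ∀ i, M i i = 0)
    (hs : ∀ i j, j ≠ i → j ≠ π i → IsUnit (wrap M M i i - wrap M M j j)) :
    ∃ (u : (CycMat N R)ˣ) (T : CycMat N R), (∀ i, (u : CycMat N R) i i = 1) ∧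
      IsLinkShaped π T ∧ M = (u : CycMat N R) * T * (↑u⁻¹ : CycMat N R) := by
  obtain ⟨u, hu, h⟩ := exists_conj_eq_zero (wrap M M) π hs
  refine ⟨u⁻¹, (u : CycMat N R) * M * (↑u⁻¹ : CycMat N R), inv_apply_self hu, ⟨fun i => ?_, ?_⟩, ?_⟩
  · rw [conj_apply_self, hM0]
  · refine eq_zero_of_commute (B := (u : CycMat N R) * wrap M M * (↑u⁻¹ : CycMat N R)) hπ (fun i => ?_) ?_ h ?_
    · rw [conj_apply_self, hM0]
    · have := mul_wrap_self_comm hM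
      calc _ = (u : CycMat N R) * (M * wrap M M) * (↑u⁻¹ : CycMat N R) := by
            simp only [mul_assoc, Units.inv_mul_cancel_left]
        _ = _ := by rw [this]; simp only [mul_assoc, Units.inv_mul_cancel_left]
    · simpa only [conj_apply_self] using hs
  · simp [mul_assoc]

/-- The only possible path is `i → π i → i`, a full turn that the degenerate product excludes unless
`π i = i`, where the entry is zero. -/
theorem IsLinkShaped.mul_self {π : Equiv.Perm (Fin N)} (hπ : ∀ i, π (π i) = i) {T : CycMat N R}
    (hT : IsLinkShaped π T) : T * T = 0 := by
  ext i k
  rw [mul_apply]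
  refine Finset.sum_eq_zero fun j _ => ?_
  split_ifs with hc
  · by_cases hj : j = π i
    · by_cases hk : k = π j
      · rw [hj, hπ] at hk
        rw [hk, cycLE_self_iff] at hc
        rw [hc, hT.1, zero_mul]
      · rw [hT.2 j k hk, mul_zero]
    · rw [hT.2 i j hj, zero_mul]
  · rfl

theorem IsLinkShaped.wrap_apply_self {π : Equiv.Perm (Fin N)} {T : CycMat N R}
    (hT : IsLinkShaped π T) (i : Fin N) : wrap T T i i = T i (π i) * T (π i) i := by
  rw [wrap_apply, Finset.sum_eq_single (π i)]
  · split_ifs with hc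
    · rw [cycLE_self_iff.1 hc, hT.1, zero_mul]
    · rfl
  · intro j _ hj
    rw [hT.2 i j hj]; simp
  · simp

/-- In normal form both sides are the product of the two entries of `T` on the orbit of `i`. Hence
the equalities defining the locus follow from its inequalities. -/
theorem wrap_apply_self_eq {M : CycMat N R} {π : Equiv.Perm (Fin N)} (hπ : ∀ i, π (π i) = i)
    (hM : M * M = 0) (hM0 : ∀ i, M i i = 0)
    (hs : ∀ i j, j ≠ i → j ≠ π i → IsUnit (wrap M M i i - wrap M M j j)) (i : Fin N) :
    wrap M M (π i) (π i) = wrap M M i i := by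
  obtain ⟨u, T, hu, hT, rfl⟩ := exists_normal_form hπ hM hM0 hs
  rw [wrap_conj_apply_self (hT.mul_self hπ) hT.1 hu, wrap_conj_apply_self (hT.mul_self hπ) hT.1 hu,
    hT.wrap_apply_self, hT.wrap_apply_self, hπ, mul_comm]

end CycMat
end BrauerLoop

/-! ### Reducedness of the locus -/

/-- The numerator of a nilpotent fraction becomes nilpotent after multiplication by a power of `g`.
In the domain `A`, either `φ g` or the image of the numerator must then vanish, and `ψ` carries this
to `S`; in the first case `S` is trivial. -/
theorem IsLocalization.Away.isReduced_of_factors {R A S : Type*} [CommRing R] [CommRing A]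
    [IsDomain A] [CommRing S] [Algebra R S] (g : R) [IsLocalization.Away g S] (φ : R →+* A)
    (ψ : A →+* S) (h : ψ.comp φ = algebraMap R S) : IsReduced S := by
  refine ⟨fun x hx => ?_⟩
  obtain ⟨n, hn⟩ := hx
  obtain ⟨⟨r, s⟩, hrs⟩ := IsLocalization.surj (Submonoid.powers g) x
  have hs : IsUnit (algebraMap R S s) := IsLocalization.map_units S s
  rw [← hs.mul_left_eq_zero, hrs]
  have h0 : algebraMap R S (r ^ n) = algebraMap R S 0 := by
    rw [map_pow, ← hrs, mul_pow, hn, zero_mul, map_zero]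
  obtain ⟨⟨_, m, rfl⟩, hc⟩ := (IsLocalization.eq_iff_exists (Submonoid.powers g) S).1 h0
  have h1 : φ g ^ m * φ r ^ n = 0 := by
    rw [← map_pow, ← map_pow, ← map_mul]
    simpa using congrArg φ hc
  rcases mul_eq_zero.1 h1 with h2 | h2
  · have hg : algebraMap R S g = 0 := by
      rw [← h, RingHom.comp_apply, eq_zero_of_pow_eq_zero h2, map_zero]
    have hu : IsUnit (algebraMap R S g) := IsLocalization.Away.algebraMap_isUnit g
    rw [hg, isUnit_zero_iff] at hu
    exact eq_zero_of_zero_eq_one hu _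
  · rw [← h, RingHom.comp_apply, eq_zero_of_pow_eq_zero h2, map_zero]

universe u in
theorem Ideal.exists_field_ringHom {A : Type u} [CommRing A] (p : Ideal A) [p.IsPrime] :
    ∃ (K : Type u) (_ : Field K) (f : A →+* K), ∀ a, f a = 0 ↔ a ∈ p :=
  ⟨FractionRing (A ⧸ p), inferInstance, (algebraMap (A ⧸ p) _).comp (Ideal.Quotient.mk p),
    fun a => by
      rw [← Ideal.Quotient.eq_zero_iff_mem]
      exact map_eq_zero_iff _ (IsFractionRing.injective (A ⧸ p) (FractionRing (A ⧸ p)))⟩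

namespace BrauerLoop

variable {N : ℕ} {R S : Type*} [CommRing R] [CommRing S]

namespace CycMat

theorem map_wrap (f : R →+* S) (P Q : CycMat N R) : map f (wrap P Q) = wrap (map f P) (map f Q) := by
  ext i k
  rw [map_apply, wrap_apply, wrap_apply, map_sum f]
  refine Finset.sum_congr rfl fun j _ => ?_
  split_ifs <;> simp

end CycMat

/-- The universal point of the Brauer loop scheme. -/
noncomputable def universalPoint (N : ℕ) : CycMat N (BrauerRing N) :=
  fun i k => Ideal.Quotient.mk (brauerIdeal N) (genericMatrix N i k)

theorem universalPoint_apply (i k : Fin N) : universalPoint N i k =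
    Ideal.Quotient.mk (brauerIdeal N) (genericMatrix N i k) := rfl

theorem universalPoint_mul_self (N : ℕ) : universalPoint N * universalPoint N = 0 := by
  let G : CycMat N (MvPolynomial (Fin N × Fin N) ℂ) := genericMatrix N
  have h : universalPoint N * universalPoint N =
      CycMat.map (Ideal.Quotient.mk (brauerIdeal N)) (G * G) := by
    rw [map_mul]; rfl
  rw [h]
  ext i k
  exact Ideal.Quotient.eq_zero_iff_mem.2 (Ideal.subset_span (Or.inl ⟨i, k, rfl⟩))

theorem universalPoint_apply_self (i : Fin N) : universalPoint N i i = 0 :=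
  Ideal.Quotient.eq_zero_iff_mem.2 (Ideal.subset_span (Or.inr ⟨i, rfl⟩))

theorem sqDiag_eq_wrap (i : Fin N) :
    sqDiag N i = CycMat.wrap (universalPoint N) (universalPoint N) i i := by
  have h : CycMat.wrap (universalPoint N) (universalPoint N) i i = _ :=
    congrFun (congrFun (CycMat.wrapProd_eq_mul (M := universalPoint N)
      (universalPoint_mul_self N)) i) i
  rw [h, sqDiag]
  refine (congrArg _ (Matrix.mul_apply (M := genericMatrix N) (N := genericMatrix N))).trans ?_
  refine (map_sum (Ideal.Quotient.mk (brauerIdeal N)) _ _).trans ?_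
  exact Finset.sum_congr rfl fun j _ => map_mul _ _ _

/-- A point of the Brauer loop scheme with values in a `ℂ`-algebra gives an algebra homomorphism
from its coordinate ring. -/
noncomputable def liftPoint {A : Type*} [CommRing A] [Algebra ℂ A] (M : CycMat N A)
    (hM : M * M = 0) (hM0 : ∀ i, M i i = 0) : BrauerRing N →ₐ[ℂ] A :=
  Ideal.Quotient.liftₐ (brauerIdeal N) (MvPolynomial.aeval fun p => M p.1 p.2) <| by
    have h : brauerIdeal N ≤
        RingHom.ker (MvPolynomial.aeval (R := ℂ) fun p : Fin N × Fin N => M p.1 p.2) := by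
      refine Ideal.span_le.2 ?_
      rintro g (⟨i, k, rfl⟩ | ⟨i, rfl⟩)
      · have := congrArg (fun P : CycMat N A => P i k) hM
        simpa [RingHom.mem_ker, CycMat.mul_apply, cprod, ← Finset.sum_filter] using this
      · simpa [RingHom.mem_ker] using hM0 i
    exact fun a ha => h ha

theorem liftPoint_universalPoint {A : Type*} [CommRing A] [Algebra ℂ A] (M : CycMat N A)
    (hM : M * M = 0) (hM0 : ∀ i, M i i = 0) (i k : Fin N) :
    liftPoint M hM hM0 (universalPoint N i k) = M i k := by
  rw [universalPoint_apply, liftPoint]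
  erw [Ideal.Quotient.liftₐ_apply, Ideal.Quotient.lift_mk]
  simp

theorem brauerRing_algHom_ext {A : Type*} [CommRing A] [Algebra ℂ A] {f g : BrauerRing N →ₐ[ℂ] A}
    (h : ∀ i k, f (universalPoint N i k) = g (universalPoint N i k)) : f = g := by
  refine Ideal.Quotient.algHom_ext ℂ (MvPolynomial.algHom_ext fun p => ?_)
  exact h p.1 p.2

/-- The product of the functions `(M²)_{ii} - (M²)_{jj}` over all `i`, `j` in different orbits
of `π`. -/
noncomputable def separator (π : Equiv.Perm (Fin N)) : BrauerRing N :=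
  ∏ p : Fin N × Fin N with p.2 ≠ p.1 ∧ p.2 ≠ π p.1, (sqDiag N p.1 - sqDiag N p.2)

section normalForm

variable (π : Equiv.Perm (Fin N))

/-- The generic matrix with unit diagonal. -/
noncomputable def genericUnipotent (N : ℕ) :
    CycMat N (MvPolynomial ((Fin N × Fin N) ⊕ Fin N) ℂ) :=
  fun i k => if i = k then 1 else MvPolynomial.X (Sum.inl (i, k))

/-- The generic matrix supported on the off-diagonal part of the permutation matrix of `π`. -/
noncomputable def genericLink : CycMat N (MvPolynomial ((Fin N × Fin N) ⊕ Fin N) ℂ) :=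
  fun i k => if k = π i ∧ k ≠ i then MvPolynomial.X (Sum.inr k) else 0

theorem isLinkShaped_genericLink : CycMat.IsLinkShaped π (genericLink π) :=
  ⟨fun _ => if_neg fun h => h.2 rfl, fun _ _ hk => if_neg fun h => hk h.1⟩

/-- The point of the Brauer loop scheme given by a ring homomorphism from its coordinate ring. -/
noncomputable def pointOf (f : BrauerRing N →+* S) : CycMat N S := CycMat.map f (universalPoint N)

theorem pointOf_mul_self (f : BrauerRing N →+* S) : pointOf f * pointOf f = 0 := by
  rw [pointOf, ← map_mul, universalPoint_mul_self, map_zero]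

theorem pointOf_apply_self (f : BrauerRing N →+* S) (i : Fin N) : pointOf f i i = 0 := by
  rw [pointOf, CycMat.map_apply, universalPoint_apply_self, map_zero]

theorem wrap_pointOf (f : BrauerRing N →+* S) (i : Fin N) :
    CycMat.wrap (pointOf f) (pointOf f) i i = f (sqDiag N i) := by
  rw [pointOf, ← CycMat.map_wrap, CycMat.map_apply, sqDiag_eq_wrap]

theorem sqDiag_sub_dvd_separator {i j : Fin N} (h1 : j ≠ i) (h2 : j ≠ π i) :
    sqDiag N i - sqDiag N j ∣ separator π := by
  have h : (i, j) ∈ Finset.univ.filter fun p : Fin N × Fin N => p.2 ≠ p.1 ∧ p.2 ≠ π p.1 :=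
    Finset.mem_filter.2 ⟨Finset.mem_univ _, h1, h2⟩
  rw [separator, ← Finset.mul_prod_erase _ _ h]
  exact dvd_mul_right _ _

theorem isUnit_wrap_pointOf_sub {f : BrauerRing N →+* S} (hf : IsUnit (f (separator π)))
    (i j : Fin N) (h1 : j ≠ i) (h2 : j ≠ π i) : IsUnit
      (CycMat.wrap (pointOf f) (pointOf f) i i - CycMat.wrap (pointOf f) (pointOf f) j j) := by
  rw [wrap_pointOf, wrap_pointOf, ← f.map_sub]
  exact isUnit_of_dvd_unit (map_dvd f (sqDiag_sub_dvd_separator π h1 h2)) hf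

theorem isReduced_of_isLocalization_away_separator (hπ : ∀ i, π (π i) = i)
    [Algebra (BrauerRing N) S] [Algebra ℂ S] [IsScalarTower ℂ (BrauerRing N) S]
    [IsLocalization.Away (separator π) S] : IsReduced S := by
  have hsep : IsUnit (algebraMap (BrauerRing N) S (separator π)) :=
    IsLocalization.Away.algebraMap_isUnit (S := S) (separator π)
  obtain ⟨u, T, hu, hT, hMu⟩ := CycMat.exists_normal_form hπ
    (pointOf_mul_self (algebraMap (BrauerRing N) S)) (pointOf_apply_self _)
    (isUnit_wrap_pointOf_sub π hsep)
  obtain ⟨W, hW⟩ := CycMat.isUnit_of_diag_eq_one (P := genericUnipotent N) fun i => if_pos rfl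
  have hG := isLinkShaped_genericLink π
  let P := (W : CycMat N _) * genericLink π * (↑W⁻¹ : CycMat N _)
  have hP : P * P = 0 := by
    have : P * P = (W : CycMat N _) * (genericLink π * genericLink π) * (↑W⁻¹ : CycMat N _) := by
      simp only [P, mul_assoc, Units.inv_mul_cancel_left]
    rw [this, hG.mul_self hπ, mul_zero, zero_mul]
  have hP0 : ∀ i, P i i = 0 := fun i => (CycMat.conj_apply_self W _ i).trans (hG.1 i)
  let φ := liftPoint P hP hP0
  -- `φ` is the family of all conjugates of link-shaped matrices, and `ψ` specialises it to the
  -- normal form `u`, `T` of the universal point. Hence `ψ ∘ φ` is the localisation map.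
  let ψ : MvPolynomial ((Fin N × Fin N) ⊕ Fin N) ℂ →ₐ[ℂ] S :=
    MvPolynomial.aeval (Sum.elim (fun p => (u : CycMat N S) p.1 p.2) fun k => T (π k) k)
  have hψW : Units.map (CycMat.map (N := N) ψ.toRingHom).toMonoidHom W = u := by
    ext i k
    change ψ ((W : CycMat N _) i k) = _
    rw [hW, genericUnipotent]
    split_ifs with h
    · rw [map_one, ← h, hu]
    · simp [ψ]
  have hψT : CycMat.map ψ.toRingHom (genericLink π) = T := by
    ext i k
    change ψ (genericLink π i k) = _
    rw [genericLink]
    split_ifs with h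
    · obtain ⟨rfl, h⟩ := h
      simp [ψ, hπ]
    · rw [map_zero]
      by_cases hk : k = π i
      · have : k = i := by_contra fun h' => h ⟨hk, h'⟩
        rw [this, hT.1]
      · rw [hT.2 i k hk]
  have hψP : CycMat.map ψ.toRingHom P = pointOf (algebraMap (BrauerRing N) S) := by
    rw [map_mul, map_mul, hψT, hMu, ← hψW, ← map_inv]
    rfl
  refine IsLocalization.Away.isReduced_of_factors (separator π) φ.toRingHom ψ.toRingHom ?_
  have : ψ.comp φ = IsScalarTower.toAlgHom ℂ (BrauerRing N) S :=
    brauerRing_algHom_ext fun i k => by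
      rw [AlgHom.comp_apply, liftPoint_universalPoint]
      exact congrArg (fun P : CycMat N S => P i k) hψP
  exact congrArg (fun f : BrauerRing N →ₐ[ℂ] S => f.toRingHom) this

theorem map_sqDiag_eq_of_isUnit (hπ : ∀ i, π (π i) = i) {f : BrauerRing N →+* S}
    (hf : IsUnit (f (separator π))) (i : Fin N) : f (sqDiag N (π i)) = f (sqDiag N i) := by
  have h := CycMat.wrap_apply_self_eq hπ (pointOf_mul_self f) (pointOf_apply_self f)
    (isUnit_wrap_pointOf_sub π hf) i
  rwa [wrap_pointOf, wrap_pointOf] at h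

theorem sqDiag_sub_mem_of_separator_notMem (hπ : ∀ i, π (π i) = i) (p : Ideal (BrauerRing N))
    [p.IsPrime] (hp : separator π ∉ p) (i : Fin N) : sqDiag N i - sqDiag N (π i) ∈ p := by
  obtain ⟨K, _, f, hf⟩ := Ideal.exists_field_ringHom p
  have h := map_sqDiag_eq_of_isUnit π hπ (isUnit_iff_ne_zero.2 fun h => hp ((hf _).1 h)) i
  rw [← hf, f.map_sub, h, sub_self]

end normalForm
end BrauerLoop

/-! ### Cotangent spaces and point derivations -/

namespace IsLocalRing

variable {K L : Type*} [Field K] [CommRing L] [Algebra K L]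

/-- Derivations of a `K`-algebra `L` at a `K`-point `ε`. -/
def pointDerivations (ε : L →ₐ[K] K) : Submodule K (L →ₗ[K] K) where
  carrier := {δ | ∀ x y, δ (x * y) = ε x * δ y + ε y * δ x}
  add_mem' := fun {a b} ha hb x y => by
    simp only [LinearMap.add_apply, ha x y, hb x y]; ring
  zero_mem' := fun x y => by simp
  smul_mem' := fun c a ha x y => by
    simp only [LinearMap.smul_apply, ha x y, smul_eq_mul]; ring

theorem pointDerivation_algebraMap {ε : L →ₐ[K] K} {δ : L →ₗ[K] K} (hδ : δ ∈ pointDerivations ε)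
    (c : K) : δ (algebraMap K L c) = 0 := by
  have h1 := hδ 1 1
  simp only [mul_one, map_one, one_mul, left_eq_add] at h1
  rw [Algebra.algebraMap_eq_smul_one, map_smul, h1, smul_zero]

variable [IsLocalRing L]

theorem mem_maximalIdeal_iff_apply_eq_zero (ε : L →ₐ[K] K) (x : L) :
    x ∈ maximalIdeal L ↔ ε x = 0 := by
  constructor
  · intro h
    by_contra h0
    have h1 : x - algebraMap K L (ε x) ∈ maximalIdeal L := fun hu => by
      have := hu.map ε
      simp at this
    have h2 : algebraMap K L (ε x) ∈ maximalIdeal L := by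
      simpa using (maximalIdeal L).sub_mem h h1
    exact h2 ((isUnit_iff_ne_zero.2 h0).map (algebraMap K L))
  · intro h hu
    have := hu.map ε
    rw [h] at this
    exact not_isUnit_zero this

theorem sub_algebraMap_mem_maximalIdeal (ε : L →ₐ[K] K) (x : L) :
    x - algebraMap K L (ε x) ∈ maximalIdeal L := by
  simp [mem_maximalIdeal_iff_apply_eq_zero ε]

/-- The point derivation of a local ring given by a linear form on its cotangent space. -/
noncomputable def dualCotangentSpaceToPointDerivations (ε : L →ₐ[K] K) :
    Module.Dual K (CotangentSpace L) →ₗ[K] pointDerivations ε where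
  toFun φ :=
    ⟨{ toFun := fun x => φ ((maximalIdeal L).toCotangent ⟨_, sub_algebraMap_mem_maximalIdeal ε x⟩)
       map_add' := fun x y => by
        rw [← map_add, ← map_add]
        congr 2
        ext
        simp; ring
       map_smul' := fun c x => by
        rw [RingHom.id_apply, ← map_smul, ← LinearMap.map_smul_of_tower]
        congr 2
        ext
        simp [Algebra.smul_def]; ring }, by
      intro x y
      have h : (maximalIdeal L).toCotangent ⟨_, sub_algebraMap_mem_maximalIdeal ε (x * y)⟩ =
          ε x • (maximalIdeal L).toCotangent ⟨_, sub_algebraMap_mem_maximalIdeal ε y⟩ +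
          ε y • (maximalIdeal L).toCotangent ⟨_, sub_algebraMap_mem_maximalIdeal ε x⟩ := by
        rw [← LinearMap.map_smul_of_tower, ← LinearMap.map_smul_of_tower, ← map_add,
          Ideal.toCotangent_eq, pow_two]
        have := Ideal.mul_mem_mul (sub_algebraMap_mem_maximalIdeal ε x)
          (sub_algebraMap_mem_maximalIdeal ε y)
        convert this using 1
        simp [Algebra.smul_def]; ring
      exact (congrArg φ h).trans (by simp)⟩
  map_add' φ ψ := by ext; simp
  map_smul' c φ := by ext; simp

theorem dualCotangentSpaceToPointDerivations_apply (ε : L →ₐ[K] K)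
    (φ : Module.Dual K (CotangentSpace L)) (x : L) :
    (dualCotangentSpaceToPointDerivations ε φ : L →ₗ[K] K) x =
      φ ((maximalIdeal L).toCotangent ⟨_, sub_algebraMap_mem_maximalIdeal ε x⟩) := rfl

theorem pointDerivation_eq_of_toCotangent_eq {ε : L →ₐ[K] K} {δ : L →ₗ[K] K}
    (hδ : δ ∈ pointDerivations ε) {x y : maximalIdeal L}
    (h : (maximalIdeal L).toCotangent x = (maximalIdeal L).toCotangent y) :
    δ x = δ y := by
  rw [Ideal.toCotangent_eq, pow_two] at h
  rw [← sub_eq_zero, ← map_sub]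
  refine Submodule.mul_induction_on h (fun a ha b hb => ?_) fun a b ha hb => ?_
  · rw [mem_maximalIdeal_iff_apply_eq_zero ε] at ha hb
    rw [hδ, ha, hb, zero_mul, zero_mul, add_zero]
  · rw [map_add, ha, hb, add_zero]

/-- A point derivation kills constants and `𝔪²`, so it is determined by the linear form it induces
on `𝔪/𝔪²`. -/
theorem dualCotangentSpaceToPointDerivations_bijective (ε : L →ₐ[K] K) :
    Function.Bijective (dualCotangentSpaceToPointDerivations ε) := by
  constructor
  · refine (injective_iff_map_eq_zero _).2 fun φ h => LinearMap.ext fun v => ?_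
    obtain ⟨x, rfl⟩ := Ideal.toCotangent_surjective _ v
    have h1 := congrArg (fun δ : pointDerivations ε => (δ : L →ₗ[K] K) (x : L)) h
    simp only [dualCotangentSpaceToPointDerivations_apply] at h1
    have hx : ε x = 0 := (mem_maximalIdeal_iff_apply_eq_zero ε _).1 x.2
    simpa [hx] using h1
  · intro δ
    have hs := Ideal.toCotangent_surjective (maximalIdeal L)
    have key : ∀ x : maximalIdeal L, (δ : L →ₗ[K] K)
        (Function.surjInv hs ((maximalIdeal L).toCotangent x) : maximalIdeal L) = (δ : L →ₗ[K] K) x := fun x =>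
      pointDerivation_eq_of_toCotangent_eq δ.2 (Function.surjInv_eq hs _)
    let φ : Module.Dual K (CotangentSpace L) :=
      { toFun := fun v => (δ : L →ₗ[K] K) (Function.surjInv hs v : maximalIdeal L)
        map_add' := fun v w => by
          obtain ⟨x, rfl⟩ := hs v
          obtain ⟨y, rfl⟩ := hs w
          rw [← map_add, key, key, key]
          simp
        map_smul' := fun c v => by
          obtain ⟨x, rfl⟩ := hs v
          rw [← LinearMap.map_smul_of_tower, key, key]
          simp }
    refine ⟨φ, Subtype.ext (LinearMap.ext fun x => ?_)⟩
    rw [dualCotangentSpaceToPointDerivations_apply]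
    change (δ : L →ₗ[K] K) (Function.surjInv hs _ : maximalIdeal L) = _
    rw [key]
    simp [pointDerivation_algebraMap δ.2]

theorem finrank_dual_cotangentSpace (ε : L →ₐ[K] K) :
    Module.finrank (ResidueField L) (Module.Dual (ResidueField L) (CotangentSpace L)) =
      Module.finrank K (pointDerivations ε) := by
  rw [Subspace.dual_finrank_eq,
    ← (LinearEquiv.ofBijective _ (dualCotangentSpaceToPointDerivations_bijective ε)).finrank_eq,
    Subspace.dual_finrank_eq]
  -- The `K`-point `ε` identifies the residue field with `K`, so the ranks over both fields agree.
  have hb : Function.Bijective (algebraMap K (ResidueField L)) := by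
    refine ⟨(algebraMap K (ResidueField L)).injective, fun y => ?_⟩
    obtain ⟨x, rfl⟩ := IsLocalRing.residue_surjective y
    refine ⟨ε x, ?_⟩
    rw [IsScalarTower.algebraMap_apply K L (ResidueField L), eq_comm, ← sub_eq_zero,
      ResidueField.algebraMap_eq, ← map_sub, residue_eq_zero_iff]
    exact sub_algebraMap_mem_maximalIdeal ε x
  exact congrArg Cardinal.toNat (rank_eq_of_equiv_equiv (algebraMap K (ResidueField L))
    (AddEquiv.refl (CotangentSpace L)) hb fun r m => by
      rw [IsScalarTower.algebraMap_apply K L (ResidueField L), algebraMap_smul, algebraMap_smul]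
      rfl).symm

end IsLocalRing

/-! ### Tangent vectors of closed subschemes of affine space -/

section tangent

open MvPolynomial TrivSqZeroExt IsLocalRing

variable {K σ : Type*} [Field K]

/-- The `K[ε]`-point of affine space with base point `p` and tangent vector `X`. -/
noncomputable def dualNumberPoint (p X : σ → K) : MvPolynomial σ K →ₐ[K] DualNumber K :=
  aeval fun s => inl (p s) + inr (X s)

theorem fst_dualNumberPoint (p X : σ → K) (f : MvPolynomial σ K) :
    fst (dualNumberPoint p X f) = eval p f := by
  have h : (fstHom K K K).comp (dualNumberPoint p X) = aeval p :=
    MvPolynomial.algHom_ext fun s => by simp [dualNumberPoint]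
  exact congrArg (fun g : MvPolynomial σ K →ₐ[K] K => g f) h

theorem snd_dualNumberPoint_mul (p X : σ → K) (f g : MvPolynomial σ K) :
    snd (dualNumberPoint p X (f * g)) =
      eval p f * snd (dualNumberPoint p X g) + eval p g * snd (dualNumberPoint p X f) := by
  rw [map_mul, snd_mul, fst_dualNumberPoint, fst_dualNumberPoint]
  simp [mul_comm]

/-- A derivation of a polynomial ring at a point is determined by its values on the variables. -/
theorem MvPolynomial.pointDerivation_ext {p : σ → K} {d e : MvPolynomial σ K →ₗ[K] K}
    (hd : ∀ f g, d (f * g) = eval p f * d g + eval p g * d f)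
    (he : ∀ f g, e (f * g) = eval p f * e g + eval p g * e f)
    (h : ∀ s, d (X s) = e (X s)) (f : MvPolynomial σ K) : d f = e f := by
  have hC : ∀ d : MvPolynomial σ K →ₗ[K] K,
      (∀ f g, d (f * g) = eval p f * d g + eval p g * d f) → ∀ c, d (C c) = 0 := by
    intro d hd c
    have h1 := hd 1 1
    simp only [mul_one, map_one, one_mul, left_eq_add] at h1
    rw [← MvPolynomial.algebraMap_eq, Algebra.algebraMap_eq_smul_one, map_smul, h1, smul_zero]
  induction f using MvPolynomial.induction_on with
  | C c => rw [hC d hd, hC e he]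
  | add f g hf hg => rw [map_add, map_add, hf, hg]
  | mul_X f s hf => rw [hd, he, hf, h]

/-- The derivative of polynomials at `p` in direction `v`. -/
noncomputable def derivativeAt (p v : σ → K) : MvPolynomial σ K →ₗ[K] K :=
  (sndHom K K) ∘ₗ (dualNumberPoint p v).toLinearMap

theorem derivativeAt_apply (p v : σ → K) (f : MvPolynomial σ K) :
    derivativeAt p v f = snd (dualNumberPoint p v f) := rfl

theorem derivativeAt_X (p v : σ → K) (s : σ) : derivativeAt p v (X s) = v s := by
  simp [derivativeAt_apply, dualNumberPoint]

theorem derivativeAt_mul (p v : σ → K) (f g : MvPolynomial σ K) :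
    derivativeAt p v (f * g) = eval p f * derivativeAt p v g + eval p g * derivativeAt p v f :=
  snd_dualNumberPoint_mul p v f g

theorem derivativeAt_add (p v w : σ → K) (f : MvPolynomial σ K) :
    derivativeAt p (v + w) f = derivativeAt p v f + derivativeAt p w f := by
  rw [← LinearMap.add_apply]
  refine MvPolynomial.pointDerivation_ext (derivativeAt_mul p _) (fun f g => ?_) (fun s => ?_) f
  · simp only [LinearMap.add_apply, derivativeAt_mul]; ring
  · simp [derivativeAt_X]

theorem derivativeAt_smul (p : σ → K) (c : K) (v : σ → K) (f : MvPolynomial σ K) :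
    derivativeAt p (c • v) f = c * derivativeAt p v f := by
  rw [← smul_eq_mul, ← LinearMap.smul_apply]
  refine MvPolynomial.pointDerivation_ext (derivativeAt_mul p _) (fun f g => ?_) (fun s => ?_) f
  · simp only [LinearMap.smul_apply, derivativeAt_mul, smul_eq_mul]; ring
  · simp [derivativeAt_X]

/-- Tangent vectors at `p` of the closed subscheme of affine space defined by `G`. -/
def tangentVectors (G : Set (MvPolynomial σ K)) (p : σ → K) : Submodule K (σ → K) where
  carrier := {v | ∀ g ∈ G, derivativeAt p v g = 0}
  add_mem' := fun {v w} hv hw g hg => by rw [derivativeAt_add, hv g hg, hw g hg, add_zero]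
  zero_mem' := fun g _ => by
    have := derivativeAt_smul p 0 0 g
    rwa [zero_smul, zero_mul] at this
  smul_mem' := fun c v hv g hg => by rw [derivativeAt_smul, hv g hg, mul_zero]

variable {L : Type*} [CommRing L] [Algebra K L]

/-- The tangent vector defined by a point derivation. -/
noncomputable def pointDerivationsToTangentVectors {G : Set (MvPolynomial σ K)} {p : σ → K} (ε : L →ₐ[K] K)
    (h : MvPolynomial σ K →ₐ[K] L) (hG : ∀ g ∈ G, h g = 0) (hp : ∀ f, ε (h f) = eval p f) :
    pointDerivations ε →ₗ[K] tangentVectors G p where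
  toFun δ := ⟨fun s => (δ : L →ₗ[K] K) (h (X s)), fun g hg => by
    have h1 := MvPolynomial.pointDerivation_ext (d := derivativeAt p _)
      (e := (δ : L →ₗ[K] K) ∘ₗ h.toLinearMap) (derivativeAt_mul p _) (fun f g => by
        simp only [LinearMap.comp_apply, AlgHom.toLinearMap_apply, map_mul]
        rw [δ.2, hp, hp]) (fun s => derivativeAt_X p _ s) g
    exact h1.trans (by simp [hG g hg])⟩
  map_add' _ _ := rfl
  map_smul' _ _ := rfl

/-- A tangent vector is a `K[ε]`-point of `R` over `p`. It extends to `L` because elements outside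
`P` have nonzero value at `p`, hence invertible image. Conversely, elements of `L` are fractions of
polynomials, so a point derivation is determined by its values on the variables. -/
theorem finrank_dual_cotangentSpace_eq_finrank_tangentVectors (G : Set (MvPolynomial σ K))
    (p : σ → K) {R : Type*} [CommRing R] [Algebra K R] (q : MvPolynomial σ K →ₐ[K] R)
    (hq : Function.Surjective q) (hker : RingHom.ker q = Ideal.span G) (P : Ideal R) [P.IsPrime]
    (hP : ∀ f, q f ∈ P ↔ eval p f = 0)
    (L : Type*) [CommRing L] [IsLocalRing L] [Algebra R L] [IsLocalization.AtPrime L P] :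
    Module.finrank (ResidueField L) (Module.Dual (ResidueField L) (CotangentSpace L)) =
      Module.finrank K (tangentVectors G p) := by
  let _ : Algebra K L := ((algebraMap R L).comp (algebraMap K R)).toAlgebra
  have : IsScalarTower K R L := IsScalarTower.of_algebraMap_eq' rfl
  have hqG : ∀ g ∈ G, q g = 0 := fun g hg => by
    rw [← RingHom.mem_ker, hker]
    exact Ideal.subset_span hg
  have hGp : ∀ g ∈ G, eval p g = 0 := fun g hg => by
    rw [← hP, hqG g hg]
    exact P.zero_mem
  have key : ∀ v ∈ tangentVectors G p, ∃ β : L →ₐ[K] DualNumber K,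
      ∀ f, β (algebraMap R L (q f)) = dualNumberPoint p v f := by
    intro v hv
    have h1 : Ideal.span G ≤ RingHom.ker (dualNumberPoint p v) := Ideal.span_le.2 fun g hg =>
      TrivSqZeroExt.ext ((fst_dualNumberPoint p v g).trans (hGp g hg)) (hv g hg)
    let α : R →ₐ[K] DualNumber K := AlgHom.liftOfSurjective q hq (dualNumberPoint p v) (hker ▸ h1)
    have hα : ∀ f, α (q f) = dualNumberPoint p v f := fun f =>
      AlgHom.liftOfSurjective_apply _ _ _ _ f
    refine ⟨IsLocalization.liftAlgHom (M := P.primeCompl) (f := α) fun y => ?_, fun f => ?_⟩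
    · obtain ⟨f, hf⟩ := hq y
      rw [← hf, hα, isUnit_iff_isUnit_fst, fst_dualNumberPoint, isUnit_iff_ne_zero, Ne, ← hP, hf]
      exact y.2
    · simp [hα]
  -- The zero tangent vector serves to construct the `K`-point `ε` of `L`.
  obtain ⟨β₀, hβ₀⟩ := key 0 (Submodule.zero_mem _)
  let ε : L →ₐ[K] K := (fstHom K K K).comp β₀
  let h : MvPolynomial σ K →ₐ[K] L :=
    (IsScalarTower.toAlgHom K R L).comp q
  have hh : ∀ f, h f = algebraMap R L (q f) := fun f => rfl
  have hG : ∀ g ∈ G, h g = 0 := fun g hg => by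
    rw [hh, hqG g hg, map_zero]
  have hp : ∀ f, ε (h f) = eval p f := fun f => by
    rw [← fst_dualNumberPoint p 0, ← hβ₀]; rfl
  have hsurj : ∀ x : L, ∃ a b, ε (h b) ≠ 0 ∧ x * h b = h a := by
    intro x
    obtain ⟨⟨a, b⟩, hab⟩ := IsLocalization.surj P.primeCompl x
    obtain ⟨a', rfl⟩ := hq a
    obtain ⟨b', hb'⟩ := hq b
    refine ⟨a', b', ?_, ?_⟩
    · rw [hp, Ne, ← hP, hb']
      exact b.2
    · rw [hh, hh, hb']; exact hab
  rw [finrank_dual_cotangentSpace ε]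
  refine (LinearEquiv.ofBijective (pointDerivationsToTangentVectors ε h hG hp) ⟨?_, ?_⟩).finrank_eq
  · refine (injective_iff_map_eq_zero _).2 fun δ hδ => Subtype.ext (LinearMap.ext fun x => ?_)
    have h0 : ∀ f, (δ : L →ₗ[K] K) (h f) = 0 := by
      refine MvPolynomial.pointDerivation_ext (p := p) (d := (δ : L →ₗ[K] K) ∘ₗ h.toLinearMap)
        (e := 0) (fun f g => ?_) (fun f g => by simp) fun s => ?_
      · simp only [LinearMap.comp_apply, AlgHom.toLinearMap_apply, map_mul]
        rw [δ.2, hp, hp]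
      · exact congrFun (congrArg Subtype.val hδ) s
    obtain ⟨a, b, hb, hx⟩ := hsurj x
    have h1 := δ.2 x (h b)
    rw [hx, h0, h0, mul_zero, zero_add] at h1
    exact (mul_eq_zero.1 h1.symm).resolve_left hb
  · rintro ⟨v, hv⟩
    obtain ⟨β, hβ⟩ := key v hv
    have hε : ∀ x, fst (β x) = ε x := by
      intro x
      obtain ⟨a, b, hb, hx⟩ := hsurj x
      have h1 : ∀ f, fst (β (h f)) = ε (h f) := fun f => by
        rw [hp, hh, hβ, fst_dualNumberPoint]
      have h2 := congrArg (fun z => fst (β z)) hx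
      have h3 := congrArg ε hx
      simp only [map_mul, fst_mul, h1] at h2 h3
      exact mul_right_cancel₀ hb (h2.trans h3.symm)
    refine ⟨⟨(sndHom K K) ∘ₗ β.toLinearMap, fun x y => ?_⟩, Subtype.ext (funext fun s => ?_)⟩
    · simp [hε, mul_comm]
    · change snd (β (h (X s))) = v s
      rw [hh, hβ]
      exact derivativeAt_X p v s

end tangent

/-! ### Counting free positions -/

namespace BrauerLoop

variable {N : ℕ}

theorem cycLE_comm_iff_not {x y z : Fin N} (h : y ≠ z) : CycLE x y z ↔ ¬ CycLE x z y := by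
  simp only [CycLE, Fin.ext_iff, Fin.le_def, ne_eq] at *; omega

theorem cycLE_comm_left_iff_not {x y z : Fin N} (hxy : x ≠ y) (hx : x ≠ z) (hy : y ≠ z) :
    CycLE x y z ↔ ¬ CycLE y x z := by
  simp only [CycLE, Fin.ext_iff, Fin.le_def, ne_eq] at *; omega

/-- The hypotheses put the four points in the cyclic order `a, a', b', b`. -/
theorem not_cycLE_of_cycLE {a a' b b' : Fin N} (haa : a ≠ a') (hbb : b ≠ b') (hab : a ≠ b)
    (hab' : a ≠ b') (hb : a' ≠ b) (hb' : a' ≠ b') (h1 : CycLE a a' b') (h2 : CycLE a b' b) :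
    ¬ CycLE a' b b' ∧ ¬ CycLE a' a b := by
  simp only [CycLE, Fin.ext_iff, Fin.le_def, ne_eq] at *; omega

namespace IsLinkPattern

variable {π : Equiv.Perm (Fin N)}

theorem fixed_unique (hπ : IsLinkPattern π) {i j : Fin N} (hi : π i = i) (hj : π j = j) :
    i = j := by
  have h : Fintype.card {i // π i = i} ≤ 1 := by rw [hπ.card_fixed]; omega
  exact congrArg Subtype.val (Fintype.card_le_one_iff.1 h ⟨i, hi⟩ ⟨j, hj⟩)

end IsLinkPattern

/-- The positions of the free coordinates of a tangent vector to the Brauer loop scheme at a matrix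
supported on `π`. -/
def IsFreePosition (π : Equiv.Perm (Fin N)) (a b : Fin N) : Prop :=
  if π b = b then a ≠ b ∧ CycLE a (π a) b else CycLE a (π b) b

instance (π : Equiv.Perm (Fin N)) (a b : Fin N) : Decidable (IsFreePosition π a b) := by
  unfold IsFreePosition
  infer_instance

section

variable {π : Equiv.Perm (Fin N)}

theorem isFreePosition_of_ne {a b : Fin N} (hb : π b ≠ b) :
    IsFreePosition π a b ↔ CycLE a (π b) b := by
  rw [IsFreePosition, if_neg hb]

theorem isFreePosition_of_eq {a b : Fin N} (hb : π b = b) :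
    IsFreePosition π a b ↔ a ≠ b ∧ CycLE a (π a) b := by
  rw [IsFreePosition, if_pos hb]

theorem not_isFreePosition_self (a : Fin N) : ¬ IsFreePosition π a a := by
  by_cases ha : π a = a
  · rw [isFreePosition_of_eq ha]; exact fun h => h.1 rfl
  · rw [isFreePosition_of_ne ha, cycLE_self_iff]; exact ha

theorem isFreePosition_apply (hπ : IsLinkPattern π) {a : Fin N} (ha : π a ≠ a) :
    IsFreePosition π a (π a) := by
  have h : π (π a) ≠ π a := by rw [hπ.involutive]; exact ha.symm
  rw [isFreePosition_of_ne h, hπ.involutive]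
  exact cycLE_left _ _

/-- An involution exchanging free and non-free positions. -/
def flipPosition (π : Equiv.Perm (Fin N)) (p : Fin N × Fin N) : Fin N × Fin N :=
  if π p.2 = p.2 then (π p.1, p.2) else (p.1, π p.2)

theorem flipPosition_flipPosition (hπ : IsLinkPattern π) (p : Fin N × Fin N) :
    flipPosition π (flipPosition π p) = p := by
  obtain ⟨a, b⟩ := p
  by_cases hb : π b = b
  · simp [flipPosition, hb, hπ.involutive]
  · simp [flipPosition, hb, hπ.involutive, Ne.symm hb]

/-- Seen from `a`, exactly one of `b`, `π b` comes first. In the column of the fixed point this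
choice degenerates and the row is flipped instead; the diagonal position there is excluded, being
its own flip. -/
theorem isFreePosition_flipPosition (hπ : IsLinkPattern π) {p : Fin N × Fin N}
    (hp : ¬ (π p.2 = p.2 ∧ p.1 = p.2)) :
    IsFreePosition π (flipPosition π p).1 (flipPosition π p).2 ↔ ¬ IsFreePosition π p.1 p.2 := by
  obtain ⟨a, b⟩ := p
  by_cases hb : π b = b
  · have hab : a ≠ b := fun h => hp ⟨hb, h⟩
    have ha : π a ≠ a := fun h => hab (hπ.fixed_unique h hb)
    have hab' : π a ≠ b := fun h => hab (by rw [← hπ.involutive a, h, hb])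
    simp only [flipPosition, hb, if_true, isFreePosition_of_eq hb, hπ.involutive]
    rw [cycLE_comm_left_iff_not ha hab' hab]
    tauto
  · have hb' : π (π b) ≠ π b := by rw [hπ.involutive]; exact Ne.symm hb
    simp only [flipPosition, hb, if_false, isFreePosition_of_ne hb, isFreePosition_of_ne hb',
      hπ.involutive]
    exact cycLE_comm_iff_not (Ne.symm hb)

theorem flipPosition_notMem (hπ : IsLinkPattern π) {p : Fin N × Fin N}
    (hp : ¬ (π p.2 = p.2 ∧ p.1 = p.2)) :
    ¬ (π (flipPosition π p).2 = (flipPosition π p).2 ∧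
      (flipPosition π p).1 = (flipPosition π p).2) := by
  obtain ⟨a, b⟩ := p
  by_cases hb : π b = b
  · simp only [flipPosition, hb, if_true, true_and]
    exact fun h => hp ⟨hb, by rw [← hπ.involutive a, h, hb]⟩
  · simp only [flipPosition, hb, if_false, hπ.involutive]
    exact fun h => hb h.1.symm

/-- The flip pairs free with non-free positions, except for the `N % 2` diagonal positions at fixed
points, so twice the count is `N² - N % 2`. -/
theorem card_isFreePosition (hπ : IsLinkPattern π) :
    (Finset.univ.filter fun p : Fin N × Fin N => IsFreePosition π p.1 p.2).card = N ^ 2 / 2 := by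
  set F := Finset.univ.filter fun p : Fin N × Fin N => IsFreePosition π p.1 p.2
  set D := Finset.univ.filter fun p : Fin N × Fin N => π p.2 = p.2 ∧ p.1 = p.2
  have hFD : ∀ p : Fin N × Fin N, IsFreePosition π p.1 p.2 → ¬ (π p.2 = p.2 ∧ p.1 = p.2) :=
    fun p h h' => not_isFreePosition_self p.2 (h'.2 ▸ h)
  have hD : D.card = N % 2 := by
    rw [← hπ.card_fixed, Fintype.card_subtype]
    refine Finset.card_nbij' Prod.snd (fun b => (b, b)) ?_ ?_ ?_ ?_
    · intro p hp; simpa [D] using (Finset.mem_filter.1 hp).2.1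
    · intro b hb; simpa [D] using hb
    · intro p hp; exact Prod.ext (Finset.mem_filter.1 hp).2.2.symm rfl
    · intro b _; rfl
  have hflip : F.card = (Fᶜ \ D).card := by
    refine Finset.card_nbij' (flipPosition π) (flipPosition π) ?_ ?_
      (fun p _ => flipPosition_flipPosition hπ p) (fun p _ => flipPosition_flipPosition hπ p)
    · intro p hp
      have hp' : IsFreePosition π p.1 p.2 := by simpa [F] using hp
      simpa [F, D, isFreePosition_flipPosition hπ (hFD p hp'), hp'] using
        flipPosition_notMem hπ (hFD p hp')
    · intro p hp
      have hp' : ¬ IsFreePosition π p.1 p.2 ∧ ¬ (π p.2 = p.2 ∧ p.1 = p.2) := by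
        simpa [F, D] using hp
      simpa [F, isFreePosition_flipPosition hπ hp'.2] using hp'.1
  have hDF : D ⊆ Fᶜ := fun p hp => by
    have := (Finset.mem_filter.1 hp).2
    simp only [F, Finset.mem_compl, Finset.mem_filter, Finset.mem_univ, true_and]
    exact fun h => hFD p h this
  have h1 := Finset.card_sdiff_add_card_eq_card hDF
  have h2 := Finset.card_add_card_compl F
  rw [Fintype.card_prod, Fintype.card_fin] at h2
  have h3 : N * N % 2 = N % 2 := by
    rcases Nat.mod_two_eq_zero_or_one N with h | h <;> simp [Nat.mul_mod, h]
  rw [pow_two]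
  omega

end

end BrauerLoop

/-! ### The linearised equations at a link matrix -/

namespace BrauerLoop

variable {N : ℕ} {π : Equiv.Perm (Fin N)} {t : Fin N → ℂ}

theorem linkMatrix_mul_diagonal_apply (hπ : IsLinkPattern π) (t : Fin N → ℂ) (i k : Fin N) :
    (linkMatrix π * Matrix.diagonal t) i k = if k = π i ∧ k ≠ i then t k else 0 := by
  have h : (i = π k ∧ i ≠ k) ↔ (k = π i ∧ k ≠ i) := by
    constructor
    · rintro ⟨rfl, h⟩; exact ⟨(hπ.involutive k).symm, h.symm⟩
    · rintro ⟨rfl, h⟩; exact ⟨(hπ.involutive i).symm, h.symm⟩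
  rw [Matrix.mul_diagonal, linkMatrix, Matrix.of_apply, ite_mul, one_mul, zero_mul, if_congr h rfl rfl]

theorem isLinkShaped_linkMatrix (hπ : IsLinkPattern π) (t : Fin N → ℂ) :
    CycMat.IsLinkShaped π (linkMatrix π * Matrix.diagonal t) :=
  ⟨fun i => by rw [linkMatrix_mul_diagonal_apply hπ]; exact if_neg fun h => h.2 rfl,
    fun i k hk => by rw [linkMatrix_mul_diagonal_apply hπ]; exact if_neg fun h => hk h.1⟩

theorem linkMatrix_mem_brauerSet (hπ : IsLinkPattern π) (t : Fin N → ℂ) :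
    linkMatrix π * Matrix.diagonal t ∈ brauerSet N :=
  ⟨(isLinkShaped_linkMatrix hπ t).mul_self hπ.involutive, (isLinkShaped_linkMatrix hπ t).1⟩

/-- The generators of the ideal of the Brauer loop scheme. -/
def brauerGenerators (N : ℕ) : Set (MvPolynomial (Fin N × Fin N) ℂ) :=
  {f | ∃ i k, f = cprod (genericMatrix N) (genericMatrix N) i k} ∪
    {f | ∃ i, f = genericMatrix N i i}

theorem derivativeAt_cprod (p v : Fin N × Fin N → ℂ) (i k : Fin N) :
    derivativeAt p v (cprod (genericMatrix N) (genericMatrix N) i k) =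
      ∑ j, if CycLE i j k then p (i, j) * v (j, k) + p (j, k) * v (i, j) else 0 := by
  rw [cprod_apply, map_sum]
  refine Finset.sum_congr rfl fun j _ => ?_
  split_ifs
  · simp [derivativeAt_mul, derivativeAt_X]
  · exact map_zero _

/-- The linearised equation at position `(i, k)`. -/
def linkEquation (π : Equiv.Perm (Fin N)) (t : Fin N → ℂ) (v : Fin N × Fin N → ℂ)
    (i k : Fin N) : ℂ :=
  (if CycLE i (π i) k ∧ π i ≠ i then t (π i) * v (π i, k) else 0) +
    if CycLE i (π k) k ∧ π k ≠ k then t k * v (i, π k) else 0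

theorem derivativeAt_cprod_linkMatrix (hπ : IsLinkPattern π) (t : Fin N → ℂ)
    (v : Fin N × Fin N → ℂ) (i k : Fin N) :
    derivativeAt (fun p => (linkMatrix π * Matrix.diagonal t) p.1 p.2) v
      (cprod (genericMatrix N) (genericMatrix N) i k) = linkEquation π t v i k := by
  rw [derivativeAt_cprod]
  simp only [linkMatrix_mul_diagonal_apply hπ]
  calc _ = ∑ x, ((if x = π i then (if CycLE i x k ∧ x ≠ i then t x * v (x, k) else 0) else 0) +
        if x = π k then (if CycLE i x k ∧ x ≠ k then t k * v (i, x) else 0) else 0) := by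
        refine Finset.sum_congr rfl fun x _ => ?_
        have hx : k = π x ↔ x = π k :=
          ⟨fun h => by rw [h, hπ.involutive], fun h => by rw [h, hπ.involutive]⟩
        simp only [hx, ne_comm (a := k)]
        split_ifs <;> first | ring1 | (exfalso; tauto)
    _ = _ := by
        rw [Finset.sum_add_distrib, Finset.sum_ite_eq', Finset.sum_ite_eq', linkEquation]
        simp

theorem mem_tangentVectors_linkMatrix (hπ : IsLinkPattern π) (t : Fin N → ℂ)
    (v : Fin N × Fin N → ℂ) :
    v ∈ tangentVectors (brauerGenerators N)
      (fun p => (linkMatrix π * Matrix.diagonal t) p.1 p.2) ↔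
      (∀ i, v (i, i) = 0) ∧ ∀ i k, linkEquation π t v i k = 0 := by
  constructor
  · intro h
    refine ⟨fun i => ?_, fun i k => ?_⟩
    · have := h _ (Or.inr ⟨i, rfl⟩)
      exact (derivativeAt_X _ v (i, i)).symm.trans this
    · rw [← derivativeAt_cprod_linkMatrix hπ]
      exact h _ (Or.inl ⟨i, k, rfl⟩)
  · rintro ⟨h1, h2⟩ g (⟨i, k, rfl⟩ | ⟨i, rfl⟩)
    · rw [derivativeAt_cprod_linkMatrix hπ, h2]
    · exact (derivativeAt_X _ v (i, i)).trans (h1 i)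

/-- The condition on `t` singling out generic points `π t`. -/
structure IsGenericFor (π : Equiv.Perm (Fin N)) (t : Fin N → ℂ) : Prop where
  ne_zero : ∀ i, t i ≠ 0
  separates : ∀ i j, j ≠ i → j ≠ π i → π i ≠ i → π j ≠ j → t i * t (π i) ≠ t j * t (π j)

/-- The equations at `(a, π b)` and `(π a, b)` involve only `v (a, b)` and `v (π a, π b)`. When `π b
≠ b`, non-freeness of `(a, b)` means that `v (a, b)` occurs in the first with coefficient `t (π b)`.
-/
theorem eq_zero_of_forall_isFreePosition (hπ : IsLinkPattern π) (ht : IsGenericFor π t)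
    {v : Fin N × Fin N → ℂ} (h0 : ∀ i, v (i, i) = 0) (h : ∀ i k, linkEquation π t v i k = 0)
    (hF : ∀ a b, IsFreePosition π a b → v (a, b) = 0) : v = 0 := by
  have inv := hπ.involutive
  funext ⟨a, b⟩
  simp only [Pi.zero_apply]
  by_cases hfree : IsFreePosition π a b
  · exact hF a b hfree
  by_cases hab : a = b
  · rw [hab, h0]
  by_cases hb : π b = b
  · have ha : π a ≠ a := fun h => hab (hπ.fixed_unique h hb)
    have hab' : π a ≠ b := fun h => hab (by rw [← inv a, h, hb])
    rw [isFreePosition_of_eq hb] at hfree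
    have hc : CycLE (π a) a b := by
      rw [cycLE_comm_left_iff_not ha hab' hab]; exact fun h => hfree ⟨hab, h⟩
    have := h (π a) b
    simp only [linkEquation, inv, hc, hb, ha.symm, ne_eq, not_true, not_false_iff, and_self,
      and_false, if_true, if_false, add_zero] at this
    exact (mul_eq_zero.1 this).resolve_left (ht.ne_zero a)
  · have hbπ : b ≠ π a := by
      rintro rfl
      exact hfree (isFreePosition_apply hπ (by rw [inv] at hb; exact Ne.symm hb))
    have hb' : b ≠ π b := Ne.symm hb
    have hπab : π a ≠ π b := fun h => hab (π.injective h)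
    rw [isFreePosition_of_ne hb, ← cycLE_comm_iff_not hb'] at hfree
    have h1 := h a (π b)
    simp only [linkEquation, inv, hfree, hb', ne_eq, not_false_iff, and_self, if_true] at h1
    split_ifs at h1 with hc
    · by_cases hfree' : IsFreePosition π (π a) (π b)
      · rw [hF _ _ hfree', mul_zero, zero_add] at h1
        exact (mul_eq_zero.1 h1).resolve_left (ht.ne_zero _)
      · have hb2 : π (π b) ≠ π b := by rw [inv]; exact hb'
        rw [isFreePosition_of_ne hb2, inv, ← cycLE_comm_iff_not hb] at hfree'
        have h2 := h (π a) b
        simp only [linkEquation, inv, hfree', hb, ne_eq, not_false_iff, and_self, if_true] at h2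
        have hs := ht.separates a b (Ne.symm hab) hbπ hc.2 hb
        split_ifs at h2 with hc'
        · have h3 : (t a * t (π a) - t b * t (π b)) * v (a, b) = 0 := by
            linear_combination t (π a) * h2 - t b * h1
          exact (mul_eq_zero.1 h3).resolve_left (sub_ne_zero.2 hs)
        · rw [zero_add] at h2
          rw [(mul_eq_zero.1 h2).resolve_left (ht.ne_zero _), mul_zero, zero_add] at h1
          exact (mul_eq_zero.1 h1).resolve_left (ht.ne_zero _)
    · rw [zero_add] at h1
      exact (mul_eq_zero.1 h1).resolve_left (ht.ne_zero _)

/-- The solution of the linearised equations with prescribed free coordinates. -/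
noncomputable def linkExtension (π : Equiv.Perm (Fin N)) (t : Fin N → ℂ) (y : Fin N × Fin N → ℂ) :
    Fin N × Fin N → ℂ := fun p =>
  if IsFreePosition π p.1 p.2 then y p
  else if p.1 ≠ p.2 ∧ π p.2 ≠ p.2 ∧ π p.1 ≠ p.1 ∧ CycLE p.1 (π p.1) (π p.2) ∧
      IsFreePosition π (π p.1) (π p.2) then
    -- For `p = (a, b)` this is the equation at `(a, π b)` solved for `v (a, b)`.
    -(t (π p.1) / t (π p.2)) * y (π p.1, π p.2) else 0

theorem linkEquation_linkExtension (hπ : IsLinkPattern π) (ht : IsGenericFor π t)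
    (y : Fin N × Fin N → ℂ) (i k : Fin N) : linkEquation π t (linkExtension π t y) i k = 0 := by
  have inv := hπ.involutive
  have hdiag : ∀ i, linkExtension π t y (i, i) = 0 := fun i => by
    simp [linkExtension, not_isFreePosition_self]
  -- In this form the equation relates `v (π i, π b)` and `v (i, b)`.
  obtain ⟨b, rfl⟩ : ∃ b, k = π b := ⟨π k, (inv k).symm⟩
  rw [linkEquation, inv]
  by_cases hib : b = i
  · subst hib
    simp [hdiag]
  by_cases hbπ : b = π i
  · subst hbπ
    by_cases hi : π i = i <;> simp [inv, cycLE_self_iff, hi]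
  have hbπ' : π i ≠ b := Ne.symm hbπ
  have hib' : i ≠ b := Ne.symm hib
  have hπ' : π i ≠ π b := fun h => hib' (π.injective h)
  have hiπ : i ≠ π b := fun h => hbπ' (by rw [h, inv])
  by_cases hb : π b = b
  · rw [if_neg (c := CycLE i b (π b) ∧ b ≠ π b) (fun h => h.2 hb.symm), add_zero]
    split_ifs with h1
    · rw [hb] at h1 ⊢
      have hf : ¬ IsFreePosition π (π i) b := by
        rw [isFreePosition_of_eq hb, inv,
          cycLE_comm_left_iff_not h1.2 hbπ' hib']
        exact fun h => h.2 h1.1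
      simp [linkExtension, hf, hb]
    · rfl
  have hb' : b ≠ π b := Ne.symm hb
  have hbb : π (π b) ≠ π b := by rw [inv]; exact hb'
  have htb := ht.ne_zero (π b)
  by_cases c2 : CycLE i b (π b)
  · have hf : ¬ IsFreePosition π i b := by
      rw [isFreePosition_of_ne hb, ← cycLE_comm_iff_not hb']; exact c2
    by_cases c1 : CycLE i (π i) (π b) ∧ π i ≠ i
    · by_cases hf' : IsFreePosition π (π i) (π b)
      · simp [linkExtension, hf, hf', c1, c2, hb', hb, hib']
        field_simp
        ring
      · simp [linkExtension, hf, hf', inv]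
    · have : ¬ (π i ≠ i ∧ CycLE i (π i) (π b) ∧ IsFreePosition π (π i) (π b)) :=
        fun h => c1 ⟨h.2.1, h.1⟩
      rw [if_neg c1]
      simp only [linkExtension, hf, this, and_false, if_false, mul_zero, add_zero, ite_self]
  · rw [if_neg (c := CycLE i b (π b) ∧ b ≠ π b) (fun h => c2 h.1), add_zero]
    split_ifs with c1
    · have h := not_cycLE_of_cycLE c1.2.symm hb' hib' hiπ hbπ' hπ' c1.1
        ((cycLE_comm_iff_not hb).2 c2)
      have hf : ¬ IsFreePosition π (π i) (π b) := by
        rw [isFreePosition_of_ne hbb, inv]; exact h.1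
      simp [linkExtension, hf, inv, h.2]
    · rfl

theorem linkExtension_apply_of_isFreePosition {a b : Fin N} (h : IsFreePosition π a b)
    (y : Fin N × Fin N → ℂ) : linkExtension π t y (a, b) = y (a, b) := if_pos h

/-- At a generic matrix supported on `π`, the free coordinates are coordinates on the tangent
space. -/
theorem finrank_tangentVectors_linkMatrix (hπ : IsLinkPattern π) (ht : IsGenericFor π t) :
    Module.finrank ℂ (tangentVectors (brauerGenerators N)
      (fun p => (linkMatrix π * Matrix.diagonal t) p.1 p.2)) = N ^ 2 / 2 := by
  set T := tangentVectors (brauerGenerators N)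
    (fun p => (linkMatrix π * Matrix.diagonal t) p.1 p.2)
  let F := Finset.univ.filter fun p : Fin N × Fin N => IsFreePosition π p.1 p.2
  let r : T →ₗ[ℂ] (F → ℂ) := (LinearMap.funLeft ℂ ℂ (Subtype.val : F → Fin N × Fin N)) ∘ₗ T.subtype
  have hr : Function.Bijective r := by
    constructor
    · refine (injective_iff_map_eq_zero _).2 fun v hv => Subtype.ext ?_
      obtain ⟨h0, h⟩ := (mem_tangentVectors_linkMatrix hπ t v.1).1 v.2
      refine eq_zero_of_forall_isFreePosition hπ ht h0 h fun a b hab => ?_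
      exact congrFun hv ⟨(a, b), Finset.mem_filter.2 ⟨Finset.mem_univ _, hab⟩⟩
    · intro y
      let y' : Fin N × Fin N → ℂ := fun p => if h : p ∈ F then y ⟨p, h⟩ else 0
      refine ⟨⟨linkExtension π t y', (mem_tangentVectors_linkMatrix hπ t _).2
        ⟨fun i => by simp [linkExtension, not_isFreePosition_self],
          linkEquation_linkExtension hπ ht y'⟩⟩, funext fun p => ?_⟩
      change linkExtension π t y' (p.1.1, p.1.2) = y p
      rw [linkExtension_apply_of_isFreePosition (Finset.mem_filter.1 p.2).2]
      exact dif_pos p.2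
  rw [(LinearEquiv.ofBijective r hr).finrank_eq, Module.finrank_fintype_fun_eq_card,
    Fintype.card_coe, card_isFreePosition hπ]

end BrauerLoop

/-! ### Transfer to the schemes -/

/-- Allowing any isomorphic local ring lets one computation serve the stalks of both `E` and `E_π`.
-/
theorem finrank_dual_cotangentSpace_of_ringEquiv {K σ : Type*} [Field K]
    (G : Set (MvPolynomial σ K)) (p : σ → K) {R : Type*} [CommRing R] [Algebra K R]
    (q : MvPolynomial σ K →ₐ[K] R) (hq : Function.Surjective q)
    (hker : RingHom.ker q = Ideal.span G) (P : Ideal R) [P.IsPrime]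
    (hP : ∀ f, q f ∈ P ↔ MvPolynomial.eval p f = 0)
    {L : Type*} [CommRing L] [IsLocalRing L] (e : Localization.AtPrime P ≃+* L) :
    Module.finrank (IsLocalRing.ResidueField L)
        (Module.Dual (IsLocalRing.ResidueField L) (IsLocalRing.CotangentSpace L)) =
      Module.finrank K (tangentVectors G p) := by
  let _ : Algebra R L := (e.toRingHom.comp (algebraMap R (Localization.AtPrime P))).toAlgebra
  have : IsLocalization.AtPrime L P :=
    (IsLocalization.isLocalization_iff_of_ringEquiv P.primeCompl e).1 inferInstance
  exact finrank_dual_cotangentSpace_eq_finrank_tangentVectors G p q hq hker P hP L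

namespace BrauerLoop
open AlgebraicGeometry
variable {N : ℕ} {π : Equiv.Perm (Fin N)}

theorem linkLocus_eq_basicOpen (hπ : IsLinkPattern π) :
    linkLocus π = (PrimeSpectrum.basicOpen (separator π) : Set (PrimeSpectrum (BrauerRing N))) := by
  ext x
  change (∀ i j : Fin N, _) ↔ separator π ∉ PrimeSpectrum.asIdeal x
  constructor
  · intro h hx
    obtain ⟨p, hp, hpx⟩ := (Ideal.IsPrime.prod_mem_iff (hp := PrimeSpectrum.isPrime x)).1 hx
    have hp := (Finset.mem_filter.1 hp).2
    exact ((h p.1 p.2).1 hpx).elim hp.1 hp.2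
  · intro hx i j
    constructor
    · intro h
      by_contra hj
      rw [not_or] at hj
      exact hx (Ideal.mem_of_dvd _ (sqDiag_sub_dvd_separator π hj.1 hj.2) h)
    · rintro (rfl | rfl)
      · rw [sub_self]; exact Ideal.zero_mem _
      · have := PrimeSpectrum.isPrime x
        exact sqDiag_sub_mem_of_separator_notMem π hπ.involutive _ hx i

theorem isOpen_linkLocus (hπ : IsLinkPattern π) : IsOpen (linkLocus π) := by
  rw [linkLocus_eq_basicOpen hπ]
  exact (PrimeSpectrum.basicOpen (separator π)).isOpen

theorem linkOpen_eq_basicOpen (hπ : IsLinkPattern π) :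
    linkOpen π = PrimeSpectrum.basicOpen (separator π) :=
  TopologicalSpace.Opens.ext <|
    ((isOpen_linkLocus hπ).interior_eq).trans (linkLocus_eq_basicOpen hπ)

theorem isReduced_linkOpen (hπ : IsLinkPattern π) : IsReduced (linkOpen π : Scheme) := by
  rw [linkOpen_eq_basicOpen hπ]
  have := isReduced_of_isLocalization_away_separator (S := Localization.Away (separator π)) π
    hπ.involutive
  exact isReduced_of_isOpenImmersion
    (basicOpenIsoSpecAway (R := CommRingCat.of (BrauerRing N)) (separator π)).hom

theorem dense_range_toImage (π : Equiv.Perm (Fin N)) :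
    Dense (Set.range (linkOpen π).ι.toImage) :=
  (linkOpen π).ι.toImage.denseRange

theorem componentι_toImage (u : (linkOpen π : Scheme)) :
    componentι π ((linkOpen π).ι.toImage u) = (linkOpen π).ι u := by
  rw [← Scheme.Hom.comp_apply, Scheme.Hom.toImage_imageι]

/-- The map from `E_π°` to its scheme-theoretic closure is an open immersion, so its dense image
inherits reducedness. -/
theorem isReduced_opensRange_toImage (hπ : IsLinkPattern π) :
    IsReduced ((linkOpen π).ι.toImage.opensRange : Scheme) := by
  have := isReduced_linkOpen hπ
  exact isReduced_of_isOpenImmersion (linkOpen π).ι.toImage.isoOpensRange.inv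

/-- The local rings of an open immersion agree. -/
noncomputable def stalkEquiv {X Y : Scheme.{0}} (f : X ⟶ Y) [IsOpenImmersion f] (x : X) :
    Y.presheaf.stalk (f x) ≃+* X.presheaf.stalk x :=
  (CategoryTheory.asIso (f.stalkMap x)).commRingCatIsoToRingEquiv

theorem isReducedAt_of_isOpenImmersion {X Y : Scheme.{0}} (f : X ⟶ Y) [IsOpenImmersion f]
    [IsReduced X] (x : X) : IsReducedAt Y (f x) :=
  isReduced_of_injective (stalkEquiv f x) (stalkEquiv f x).injective

theorem dense_preimage_linkOpen (π : Equiv.Perm (Fin N)) :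
    Dense (componentι π ⁻¹' (linkOpen π : Set (brauerScheme N))) := by
  refine (dense_range_toImage π).mono ?_
  rintro _ ⟨u, rfl⟩
  rw [Set.mem_preimage, componentι_toImage]
  exact u.2

theorem mk_mem_matrixPoint_iff {M : Matrix (Fin N) (Fin N) ℂ} (hM : M ∈ brauerSet N)
    (f : MvPolynomial (Fin N × Fin N) ℂ) :
    Ideal.Quotient.mk (brauerIdeal N) f ∈ PrimeSpectrum.asIdeal (matrixPoint M hM) ↔
      MvPolynomial.eval (fun p => M p.1 p.2) f = 0 := Iff.rfl

/-- The tangent space at a generic matrix supported on `π`, computed in any local ring isomorphic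
to that of the Brauer loop scheme. -/
theorem finrank_dual_cotangentSpace_matrixPoint (hπ : IsLinkPattern π) {t : Fin N → ℂ}
    (ht : IsGenericFor π t) (hM : linkMatrix π * Matrix.diagonal t ∈ brauerSet N)
    {L : Type} [CommRing L] [IsLocalRing L]
    (e : (brauerScheme N).presheaf.stalk (matrixPoint _ hM) ≃+* L) :
    Module.finrank (IsLocalRing.ResidueField L)
      (Module.Dual (IsLocalRing.ResidueField L) (IsLocalRing.CotangentSpace L)) = N ^ 2 / 2 := by
  let x : PrimeSpectrum (BrauerRing N) := matrixPoint _ hM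
  rw [← finrank_tangentVectors_linkMatrix hπ ht]
  exact finrank_dual_cotangentSpace_of_ringEquiv (brauerGenerators N) _
    (Ideal.Quotient.mkₐ ℂ (brauerIdeal N)) (Ideal.Quotient.mkₐ_surjective ℂ (brauerIdeal N))
    (Ideal.Quotient.mkₐ_ker ℂ (brauerIdeal N)) x.asIdeal (mk_mem_matrixPoint_iff hM)
    ((Spec.stalkIso (CommRingCat.of (BrauerRing N)) x).symm.commRingCatIsoToRingEquiv.trans e)

/-- The value of `(M²)_{ii}` at `M = π t`, as a polynomial in `t`. -/
noncomputable def linkSquare (π : Equiv.Perm (Fin N)) (i : Fin N) : MvPolynomial (Fin N) ℂ :=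
  if π i = i then 0 else MvPolynomial.X i * MvPolynomial.X (π i)

theorem eval_linkSquare (t : Fin N → ℂ) (i : Fin N) :
    MvPolynomial.eval t (linkSquare π i) = if π i = i then 0 else t i * t (π i) := by
  rw [linkSquare]; split_ifs <;> simp

theorem linkMatrix_sq_apply_self (hπ : IsLinkPattern π) (t : Fin N → ℂ) (i : Fin N) :
    ((linkMatrix π * Matrix.diagonal t) * (linkMatrix π * Matrix.diagonal t)) i i =
      MvPolynomial.eval t (linkSquare π i) := by
  rw [eval_linkSquare, Matrix.mul_apply, Finset.sum_eq_single (π i)]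
  · simp only [linkMatrix_mul_diagonal_apply hπ, hπ.involutive]
    by_cases h : π i = i
    · simp [h]
    · simp [h, Ne.symm h, mul_comm]
  · intro j _ hj
    rw [(isLinkShaped_linkMatrix hπ t).2 i j hj, zero_mul]
  · simp

/-- A polynomial whose non-vanishing at `t` makes `t` generic. -/
noncomputable def genericityPolynomial (π : Equiv.Perm (Fin N)) : MvPolynomial (Fin N) ℂ :=
  (∏ i, MvPolynomial.X i) *
    ∏ p : Fin N × Fin N with p.2 ≠ p.1 ∧ p.2 ≠ π p.1, (linkSquare π p.1 - linkSquare π p.2)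

theorem linkSquare_ne (hπ : IsLinkPattern π) {i j : Fin N} (h1 : j ≠ i) (h2 : j ≠ π i) :
    linkSquare π i ≠ linkSquare π j := by
  -- There is at most one fixed point, so `i` and `j` may be exchanged to make `i` non-fixed.
  wlog hi : π i ≠ i generalizing i j
  · rw [not_not] at hi
    have hj : π j ≠ j := fun hj => h1 (hπ.fixed_unique hj hi)
    exact (this h1.symm (fun h => h2 (by rw [h, hπ.involutive])) hj).symm
  intro h
  -- At the indicator of the orbit of `i` the two sides take the values `1` and `0`.
  have := congrArg (MvPolynomial.eval fun k => if k = i ∨ k = π i then (1 : ℂ) else 0) h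
  rw [eval_linkSquare, eval_linkSquare] at this
  simp [hi, h1, h2] at this

theorem genericityPolynomial_ne_zero (hπ : IsLinkPattern π) : genericityPolynomial π ≠ 0 := by
  refine mul_ne_zero (Finset.prod_ne_zero_iff.2 fun i _ => MvPolynomial.X_ne_zero i)
    (Finset.prod_ne_zero_iff.2 fun p hp => sub_ne_zero.2 ?_)
  have hp := (Finset.mem_filter.1 hp).2
  exact linkSquare_ne hπ hp.1 hp.2

theorem eval_linkSquare_ne {t : Fin N → ℂ} (ht : MvPolynomial.eval t (genericityPolynomial π) ≠ 0)
    {i j : Fin N} (h1 : j ≠ i) (h2 : j ≠ π i) :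
    MvPolynomial.eval t (linkSquare π i) ≠ MvPolynomial.eval t (linkSquare π j) := by
  rw [genericityPolynomial, map_mul, map_prod, map_prod] at ht
  have := Finset.prod_ne_zero_iff.1 (right_ne_zero_of_mul ht) (i, j)
    (Finset.mem_filter.2 ⟨Finset.mem_univ _, h1, h2⟩)
  rwa [map_sub, sub_ne_zero] at this

theorem isGenericFor_of_eval_ne_zero {t : Fin N → ℂ}
    (ht : MvPolynomial.eval t (genericityPolynomial π) ≠ 0) : IsGenericFor π t where
  ne_zero i := by
    rw [genericityPolynomial, map_mul, map_prod] at ht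
    simpa using Finset.prod_ne_zero_iff.1 (left_ne_zero_of_mul ht) i (Finset.mem_univ i)
  separates i j h1 h2 hi hj := by
    have := eval_linkSquare_ne ht h1 h2
    rwa [eval_linkSquare, eval_linkSquare, if_neg hi, if_neg hj] at this

theorem matrixPoint_mem_linkOpen (hπ : IsLinkPattern π) {t : Fin N → ℂ}
    (ht : MvPolynomial.eval t (genericityPolynomial π) ≠ 0)
    (hM : linkMatrix π * Matrix.diagonal t ∈ brauerSet N) : matrixPoint _ hM ∈ linkOpen π := by
  rw [linkOpen_eq_basicOpen hπ]
  intro hx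
  let x : PrimeSpectrum (BrauerRing N) := matrixPoint _ hM
  obtain ⟨p, hp, hpx⟩ := (Ideal.IsPrime.prod_mem_iff (hp := x.isPrime)).1 hx
  have hp := (Finset.mem_filter.1 hp).2
  refine eval_linkSquare_ne ht hp.1 hp.2 ?_
  rw [sqDiag, sqDiag, ← map_sub] at hpx
  have h := (mk_mem_matrixPoint_iff hM _).1 hpx
  rw [map_sub, sub_eq_zero] at h
  have hsq : ∀ i, MvPolynomial.eval (fun p => (linkMatrix π * Matrix.diagonal t) p.1 p.2)
      ((genericMatrix N * genericMatrix N) i i) = MvPolynomial.eval t (linkSquare π i) := fun i => by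
    rw [← linkMatrix_sq_apply_self hπ, Matrix.mul_apply, Matrix.mul_apply]
    simp
  rwa [hsq, hsq] at h

end BrauerLoop

theorem mainTheorem8 (N : ℕ) (hN : 0 < N) (π : Equiv.Perm (Fin N))
    (hπ : BrauerLoop.IsLinkPattern π) :
    -- the locus whose closure is `E_π` is open in `E`
    IsOpen (BrauerLoop.linkLocus π) ∧
    -- for generic diagonal `t`: `E_π` and `E` are reduced at the point `π t` of `E_π`, with Zariski
    -- tangent space of dimension `⌊N² / 2⌋`
    (∃ f : MvPolynomial (Fin N) ℂ, f ≠ 0 ∧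
      ∀ t : Fin N → ℂ, MvPolynomial.eval t f ≠ 0 →
        ∃ h : BrauerLoop.linkMatrix π * Matrix.diagonal t ∈ BrauerLoop.brauerSet N,
        ∃ y : BrauerLoop.component π,
          BrauerLoop.componentι π y =
              BrauerLoop.matrixPoint (BrauerLoop.linkMatrix π * Matrix.diagonal t) h ∧
            BrauerLoop.IsReducedAt (BrauerLoop.component π) y ∧
            BrauerLoop.tangentDim (BrauerLoop.component π) y = N ^ 2 / 2 ∧
            BrauerLoop.IsReducedAt (BrauerLoop.brauerScheme N) (BrauerLoop.componentι π y) ∧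
            BrauerLoop.tangentDim (BrauerLoop.brauerScheme N) (BrauerLoop.componentι π y) =
              N ^ 2 / 2) ∧
    -- `E_π` is generically reduced
    (∃ V : (BrauerLoop.component π).Opens, Dense (V : Set (BrauerLoop.component π)) ∧
      AlgebraicGeometry.IsReduced V) ∧
    -- `E` is generically reduced along `E_π`
    (∃ W : (BrauerLoop.brauerScheme N).Opens,
      Dense (BrauerLoop.componentι π ⁻¹' (W : Set (BrauerLoop.brauerScheme N))) ∧
        AlgebraicGeometry.IsReduced W) := by
  have hopen := BrauerLoop.isReduced_linkOpen hπ
  refine ⟨BrauerLoop.isOpen_linkLocus hπ,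
    ⟨BrauerLoop.genericityPolynomial π, BrauerLoop.genericityPolynomial_ne_zero hπ,
      fun t ht => ⟨BrauerLoop.linkMatrix_mem_brauerSet hπ t, ?_⟩⟩,
    ⟨_, BrauerLoop.dense_range_toImage π, BrauerLoop.isReduced_opensRange_toImage hπ⟩,
    ⟨_, BrauerLoop.dense_preimage_linkOpen π, hopen⟩⟩
  have hM := BrauerLoop.linkMatrix_mem_brauerSet hπ t
  have hgen := BrauerLoop.isGenericFor_of_eval_ne_zero ht
  let u : (BrauerLoop.linkOpen π : AlgebraicGeometry.Scheme) :=
    ⟨BrauerLoop.matrixPoint _ hM, BrauerLoop.matrixPoint_mem_linkOpen hπ ht hM⟩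
  have hu : BrauerLoop.componentι π ((BrauerLoop.linkOpen π).ι.toImage u) =
      BrauerLoop.matrixPoint _ hM := BrauerLoop.componentι_toImage u
  refine ⟨(BrauerLoop.linkOpen π).ι.toImage u, hu,
    BrauerLoop.isReducedAt_of_isOpenImmersion _ u, ?_, ?_, ?_⟩
  -- The stalks of `E` and `E_π` are both identified with that of `E_π°`.
  · exact BrauerLoop.finrank_dual_cotangentSpace_matrixPoint hπ hgen hM
      ((BrauerLoop.stalkEquiv (BrauerLoop.linkOpen π).ι u).trans
        (BrauerLoop.stalkEquiv (BrauerLoop.linkOpen π).ι.toImage u).symm)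
  · rw [hu]
    exact BrauerLoop.isReducedAt_of_isOpenImmersion (BrauerLoop.linkOpen π).ι u
  · rw [hu]
    exact BrauerLoop.finrank_dual_cotangentSpace_matrixPoint hπ hgen hM (RingEquiv.refl _)
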